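/- **Setting.** Let $\mathcal M=\{x\in\mathbb R^4: x_0^2+x_1^2=1\}$ be the planar unit dual quaternions with composition $x\boxplus y=(x_0y_0-x_1y_1,\;x_1y_0+x_0y_1,\;x_2y_0+x_3y_1+x_0y_2-x_1y_3,\;x_3y_0-x_2y_1+x_1y_2+x_0y_3)$, identity $\mathbb 1=(1,0,0,0)$ and inverse $x^{-1}=(x_0,-x_1,-x_2,-x_3)$. Let $\varphi(x)\in(-\pi/2,\pi/2]$ be the four-quadrant angle of $(x_0,x_1)$, reduced modulo $\pi$; put $\mathrm{Log}_{\mathbb 1}(x)=\mathrm{sinc}(\varphi(x))^{-1}(x_1,x_2,x_3)$, $\mathrm{Exp}_{\mathbb 1}(v)=(\cos v_1,\mathrm{sinc}(v_1)v)$ and $\mathrm{Exp}_x(y)=x\boxplus\mathrm{Exp}_{\mathbb 1}((x^{-1}\boxplus y)_{1:3})$. A pose graph consists of a finite vertex set $\mathcal V$, $|\mathcal V|=N$, directed edges $\mathcal E\subseteq\mathcal V\times\mathcal V$ whose underlying undirected graph is connected, measurements $\tilde z_{ij}\in\mathcal M$, positive definite covariances $\Sigma_{ij}\in\mathbb R^{3\times3}$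 with $\Omega_{ij}=\Sigma_{ij}^{-1}$, and a set of anchored vertices $a$, whose poses are fixed at $x_a=\mathbb 1$. The search space is the set of $\mathcal X=(x_i)_{i\in\mathcal V}\in\mathcal M^N\subset\mathbb R^{4N}$ with $x_a=\mathbb 1$ for all anchored $a$; it carries the Euclidean metric, tangent vectors vanish at anchored vertices, and $\mathrm{Exp}_{\mathcal X}$ acts blockwise. The objective is $$\mathcal F(\mathcal X)=\tfrac12\sum_{(i,j)\in\mathcal E}e_{ij}^\top\Omega_{ij}e_{ij},\qquad e_{ij}=\mathrm{Log}_{\mathbb 1}(r_{ij}),\qquad r_{ij}=\tilde z_{ij}^{-1}\boxplus x_i^{-1}\boxplus x_j .$$ Let $A_{ij},B_{ij}$ be the Jacobians of $e_{ij}$ in $x_i,x_j$, given by the chain rule with $d\varphi=(r_0\,dr_1-r_1\,dr_0)/(r_0^2+r_1^2)$ (where the first coordinate $r_0$ of $r_{ij}$ vanishes, $e_{ij}$ is not differentiable and the same formula is used, with the value $\varphi=\pi/2$). Let $\mathrm{grad}\,\mathcal F(\mathcal X)$ be the orthogonal projection to the tangent space of the vector of $\mathbb R^{4N}$ that is the sum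 over the edges of $A_{ij}^\top\Omega_{ij}e_{ij}$ in block $i$ and $B_{ij}^\top\Omega_{ij}e_{ij}$ in block $j$, and let $\mathcal H(\mathcal X)$ be the Riemannian Gauss–Newton operator $\sum_{(i,j)}P_{\mathcal X}R_{ij}P_{\mathcal X}$, where $P_{\mathcal X}$ is that projection and $R_{ij}$ has the blocks $A^\top\Omega A,\,A^\top\Omega B,\,B^\top\Omega A,\,B^\top\Omega B$ (indices $ij$ omitted). **Algorithm.** Parameters $\bar\Delta>0$, $\rho'\in(0,\tfrac14)$, $\Delta_0\in(0,\bar\Delta]$, $\mathcal X_0$ in the search space. At step $k$, $\mathcal S_k$ is the output of Steihaug–Toint truncated conjugate gradients (at least one inner iteration; exit at the boundary on nonpositive curvature or when the trust region is exceeded; interior exit when the residual has norm at most $\|g\|\min(\|g\|^\theta,\kappa)$ or after a prescribed number of inner iterations) for the model $\hat m_k(\mathcal S)=\mathcal F(\mathcal X_k)+\mathcal S^\top g+\tfrac12\mathcal S^\top\mathcal H(\mathcal X_k)\mathcal S$, $g=\mathrm{grad}\,\mathcal F(\mathcal X_k)$, on $\|\mathcal S\|\le\Delta_k$. With $\rho_k=\frac{\mathcal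 F(\mathrm{Exp}_{\mathcal X_k}(0))-\mathcal F(\mathrm{Exp}_{\mathcal X_k}(\mathcal S_k))}{\hat m_k(0)-\hat m_k(\mathcal S_k)}$, the radius becomes $\tfrac14\Delta_k$ if $\rho_k<\tfrac14$, $\min\{2\Delta_k,\bar\Delta\}$ if $\rho_k>\tfrac34$ and $\|\mathcal S_k\|=\Delta_k$, and $\Delta_k$ otherwise; $\mathcal X_{k+1}=\mathrm{Exp}_{\mathcal X_k}(\mathcal S_k)$ if $\rho_k>\rho'$ and $\mathcal X_{k+1}=\mathcal X_k$ otherwise. The algorithm stops at the first $k$ with $\|\mathrm{grad}\,\mathcal F(\mathcal X_k)\|\le\varepsilon_g$. **Theorem.** Let $\mathcal X_0$ be any point of the search space. 1. $\mathcal F$ has a global minimizer $\mathcal X^\star$ on the search space. 2. If at least one vertex is anchored, then for every $\bar\Delta>0$ there are $L_g\ge0$ and $\beta>0$ such that for all $\mathcal X$ in the search space with $\mathcal F(\mathcal X)\le\mathcal F(\mathcal X_0)$: (a) $\mathcal F(\mathrm{Exp}_{\mathcal X}(\mathcal S))\le\mathcal F(\mathcal X)+\mathcal S^\top\mathrm{grad}\,\mathcal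 F(\mathcal X)+\frac{L_g}2\|\mathcal S\|^2$ for all tangent $\mathcal S$ with $\|\mathcal S\|\le\bar\Delta$; (b) $\big|\mathcal F(\mathrm{Exp}_{\mathcal X}(\mathcal S))-(\mathcal F(\mathcal X)+\mathcal S^\top\mathrm{grad}\,\mathcal F(\mathcal X))\big|\le\frac{L_g}2\|\mathcal S\|^2$ for those $\mathcal S$ for which no residual $r_{ij}$ has first coordinate $0$ at any point $\mathrm{Exp}_{\mathcal X}(t\mathcal S)$, $0\le t\le1$; (c) $\|\mathcal H(\mathcal X)\mathcal S\|\le\beta$ for all unit tangent $\mathcal S$. 3. For all parameters of the algorithm, all iterates lie in the search space and satisfy $\mathcal F(\mathcal X_k)\le\mathcal F(\mathcal X_0)$. If $L_g\ge0$ and $\beta>0$ satisfy (a) and (c) at the iterates computed before the algorithm stops (in particular, if they are as in 2), $\lambda_g=\frac14\min\{\frac1\beta,\frac1{2(L_g+\beta)}\}$ and $0<\varepsilon_g\le\Delta_0/\lambda_g$, then the algorithm reaches an iterate with $\|\mathrm{grad}\,\mathcal F(\mathcal X_k)\|\le\varepsilon_g$ after $k$ iterations, for some $$k\le\frac{\mathcal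 F(\mathcal X_0)-\mathcal F(\mathcal X^\star)}{\rho'\lambda_g}\,\frac{3}{\varepsilon_g^2}+\frac12\log_2\!\Big(\frac{\Delta_0}{\lambda_g\varepsilon_g}\Big).$$ -/

import Mathlib

noncomputable section

namespace PUDQ

open scoped Matrix

/-! ## The planar unit dual quaternion group -/

/-- Composition `x ⊞ y`, i.e. multiplication of `x₀ + k x₁ + ε (i x₂ + j x₃)` with
`y₀ + k y₁ + ε (i y₂ + j y₃)`. -/
def mul (x y : Fin 4 → ℝ) : Fin 4 → ℝ :=
  ![x 0 * y 0 - x 1 * y 1,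
    x 1 * y 0 + x 0 * y 1,
    x 2 * y 0 + x 3 * y 1 + x 0 * y 2 - x 1 * y 3,
    x 3 * y 0 - x 2 * y 1 + x 1 * y 2 + x 0 * y 3]

/-- The identity element. -/
def one : Fin 4 → ℝ := ![1, 0, 0, 0]

/-- The inverse. -/
def inv (x : Fin 4 → ℝ) : Fin 4 → ℝ := ![x 0, -x 1, -x 2, -x 3]

/-- The manifold `𝓜 = {x ∈ ℝ⁴ | x₀² + x₁² = 1}`. -/
def M : Set (Fin 4 → ℝ) := {x | x 0 ^ 2 + x 1 ^ 2 = 1}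

/-- The last three entries of a vector in `ℝ⁴`. -/
def tail (x : Fin 4 → ℝ) : Fin 3 → ℝ := ![x 1, x 2, x 3]

/-- Wrapping of an angle in `(-π, π]` to `(-π/2, π/2]`. -/
def wrap (α : ℝ) : ℝ :=
  if α ≤ -(Real.pi / 2) then α + Real.pi
  else if Real.pi / 2 < α then α - Real.pi
  else α

/-- The half-angle `φ(x) ∈ (-π/2, π/2]`; `Complex.arg` is the four-quadrant arctangent. -/
def phi (x : Fin 4 → ℝ) : ℝ := wrap (Complex.arg ⟨x 0, x 1⟩)

/-- `γ(x) = sinc (φ(x))`. -/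
def gam (x : Fin 4 → ℝ) : ℝ := Real.sinc (phi x)

/-- The logarithm map at the identity, `Log₁ x = γ(x)⁻¹ [x₁, x₂, x₃]`. -/
def logOne (x : Fin 4 → ℝ) : Fin 3 → ℝ := (1 / gam x) • tail x

/-- The exponential map at the identity, `Exp₁ v = [cos v₁, sinc(v₁) v]`. -/
def expOne (v : Fin 3 → ℝ) : Fin 4 → ℝ :=
  ![Real.cos (v 0), Real.sinc (v 0) * v 0, Real.sinc (v 0) * v 1, Real.sinc (v 0) * v 2]

/-- The exponential map at `x`, `Exp_x y = x ⊞ Exp₁((x⁻¹ ⊞ y)_{1:3})`. -/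
def expAt (x y : Fin 4 → ℝ) : Fin 4 → ℝ := mul x (expOne (tail (mul (inv x) y)))

/-- `f₁(φ) = (sin φ - φ cos φ) / sin² φ`, the derivative of `φ / sin φ = 1 / sinc φ`
(with the value `0` at `φ = 0`, as it should be). -/
def f1 (φ : ℝ) : ℝ := (Real.sin φ - φ * Real.cos φ) / Real.sin φ ^ 2

/-- The derivative of `logOne` at `r` in the direction `dr`, computed by the chain rule with
`dφ = (r₀ dr₁ - r₁ dr₀) / (r₀² + r₁²)`. At `r₀ = 0`, where `logOne` has a kink, the formula
is evaluated with the value `φ(r) = π/2` that `wrap` selects. -/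
def dLogOne (r dr : Fin 4 → ℝ) : Fin 3 → ℝ :=
  (1 / gam r) • tail dr
    + (f1 (phi r) * ((r 0 * dr 1 - r 1 * dr 0) / (r 0 ^ 2 + r 1 ^ 2))) • tail r

/-! ## Pose graphs and the maximum likelihood objective -/

/-- A pose graph with vertex set `V`: directed edges `(i, j)`, relative pose measurements in
`𝓜`, positive definite noise covariances, and the set of anchored vertices, whose poses are
kept at the identity. -/
structure PoseGraph (V : Type*) where
  edges : Finset (V × V)
  meas : V × V → Fin 4 → ℝ
  meas_mem : ∀ e ∈ edges, meas e ∈ M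
  cov : V × V → Matrix (Fin 3) (Fin 3) ℝ
  cov_posDef : ∀ e ∈ edges, (cov e).PosDef
  anchors : Finset V

/-- The ambient Euclidean space `ℝ^{4N}`, `N = |V|`. -/
abbrev Amb (V : Type*) : Type _ := EuclideanSpace ℝ (V × Fin 4)

/-- The `i`-th block of a vector in `ℝ^{4N}`. -/
def blk {V : Type*} (X : Amb V) (i : V) : Fin 4 → ℝ := fun l => X (i, l)

/-- Stacking of blocks into a vector in `ℝ^{4N}`. -/
def vec {V : Type*} (x : V → Fin 4 → ℝ) : Amb V := WithLp.toLp 2 (fun p => x p.1 p.2)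

/-- The exponential map on `𝓜^N`, blockwise. -/
def Exp {V : Type*} (X S : Amb V) : Amb V := vec fun i => expAt (blk X i) (blk S i)

namespace PoseGraph

variable {V : Type*} [Fintype V] [DecidableEq V] (G : PoseGraph V)

/-- The search space: points of `𝓜^N` whose anchored poses are the identity. -/
def space : Set (Amb V) :=
  {X | (∀ i, blk X i ∈ M) ∧ ∀ a ∈ G.anchors, blk X a = one}

/-- The tangent space of the search space at `X`. -/
def tangent (X : Amb V) : Set (Amb V) :=
  {S | (∀ i, blk X i 0 * blk S i 0 + blk X i 1 * blk S i 1 = 0) ∧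
    ∀ a ∈ G.anchors, blk S a = 0}

/-- The orthogonal projector `𝓟_X` onto the tangent space: the blocks are
`I - P̃ x xᵀ P̃` with `P̃ = diag(1,1,0,0)` for free vertices and `0` for anchored ones. -/
def proj (X U : Amb V) : Amb V := vec fun i =>
  if i ∈ G.anchors then 0 else
    ![blk U i 0 - (blk X i 0 * blk U i 0 + blk X i 1 * blk U i 1) * blk X i 0,
      blk U i 1 - (blk X i 0 * blk U i 0 + blk X i 1 * blk U i 1) * blk X i 1,
      blk U i 2, blk U i 3]

/-- The information matrix `Ω_{ij} = Σ_{ij}⁻¹`. -/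
def info (e : V × V) : Matrix (Fin 3) (Fin 3) ℝ := (G.cov e)⁻¹

/-- The geodesic residual `r_{ij} = z_{ij}⁻¹ ⊞ x_i⁻¹ ⊞ x_j`. -/
def res (e : V × V) (X : Amb V) : Fin 4 → ℝ :=
  mul (mul (inv (G.meas e)) (inv (blk X e.1))) (blk X e.2)

/-- The tangent residual `e_{ij} = Log₁ r_{ij}`. -/
def err (e : V × V) (X : Amb V) : Fin 3 → ℝ := logOne (G.res e X)

/-- The maximum likelihood objective `F(X) = ½ ∑ e_{ij}ᵀ Ω_{ij} e_{ij}`. -/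
def obj (X : Amb V) : ℝ :=
  1 / 2 * ∑ e ∈ G.edges, G.err e X ⬝ᵥ (G.info e *ᵥ G.err e X)

/-- The Jacobian `A_{ij} = ∂ e_{ij} / ∂ x_i`. -/
def jacA (e : V × V) (X : Amb V) : Matrix (Fin 3) (Fin 4) ℝ :=
  Matrix.of fun m l => dLogOne (G.res e X)
    (mul (mul (inv (G.meas e)) (inv (Pi.single l 1))) (blk X e.2)) m

/-- The Jacobian `B_{ij} = ∂ e_{ij} / ∂ x_j`. -/
def jacB (e : V × V) (X : Amb V) : Matrix (Fin 3) (Fin 4) ℝ :=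
  Matrix.of fun m l => dLogOne (G.res e X)
    (mul (mul (inv (G.meas e)) (inv (blk X e.1))) (Pi.single l 1)) m

/-- The vector of `ℝ^{4N}` with `A_{ij}ᵀ w` added in block `i` and `B_{ij}ᵀ w` in block `j`. -/
def jacT (e : V × V) (X : Amb V) (w : Fin 3 → ℝ) : Amb V := vec fun l =>
  (if l = e.1 then (G.jacA e X)ᵀ *ᵥ w else 0) + (if l = e.2 then (G.jacB e X)ᵀ *ᵥ w else 0)

/-- The Euclidean gradient of the objective. -/
def egrad (X : Amb V) : Amb V :=
  ∑ e ∈ G.edges, G.jacT e X (G.info e *ᵥ G.err e X)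

/-- The Riemannian gradient `grad F(X) = 𝓟_X ∂F(X)`. -/
def grad (X : Amb V) : Amb V := G.proj X (G.egrad X)

/-- The Riemannian Gauss-Newton operator `H(X) = ∑ 𝓟_X R_{ij}(X) 𝓟_X`, where `R_{ij}` has the
blocks `AᵀΩA`, `AᵀΩB`, `BᵀΩA`, `BᵀΩB`. -/
def hess (X U : Amb V) : Amb V :=
  ∑ e ∈ G.edges, G.proj X (G.jacT e X (G.info e *ᵥ
    (G.jacA e X *ᵥ blk (G.proj X U) e.1 + G.jacB e X *ᵥ blk (G.proj X U) e.2)))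

/-- The quadratic model `m̂(S) = F(X) + Sᵀ grad F(X) + ½ Sᵀ H(X) S`. -/
def model (X S : Amb V) : ℝ :=
  G.obj X + inner ℝ S (G.grad X) + 1 / 2 * inner ℝ S (G.hess X S)

end PoseGraph

/-! ## Truncated conjugate gradients -/

section TCG

variable {E : Type*} [NormedAddCommGroup E] [InnerProductSpace ℝ E]

/-- The nonnegative `t` with `‖v + t p‖ = Δ` (for `‖v‖ ≤ Δ` and `p ≠ 0`). -/
def toBoundary (Δ : ℝ) (v p : E) : ℝ :=
  (-inner ℝ v p + Real.sqrt (inner ℝ v p ^ 2 + ‖p‖ ^ 2 * (Δ ^ 2 - ‖v‖ ^ 2))) / ‖p‖ ^ 2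

open Classical in
/-- The loop of the Steihaug-Toint method for `min ½⟨v, Hv⟩ - ⟨b, v⟩` subject to `‖v‖ ≤ Δ`, with
at most the given number of inner iterations left. The current iterate is `v`, its residual is
`r = b - Hv` and the search direction is `p`. The loop is left at the boundary when nonpositive
curvature is met or the trust region is exceeded, and in the interior when
`‖r‖ ≤ ‖b‖ min(‖b‖^θ, κ)`. -/
def tcgLoop (H : E → E) (b : E) (Δ κ θ : ℝ) : ℕ → E → E → E → E
  | 0, v, _, _ => v
  | n + 1, v, r, p =>
    let α := ‖r‖ ^ 2 / inner ℝ p (H p)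
    let v' := v + α • p
    let r' := r - α • H p
    if inner ℝ p (H p) ≤ 0 ∨ Δ ≤ ‖v'‖ then v + toBoundary Δ v p • p
    else if ‖r'‖ ≤ ‖b‖ * min (‖b‖ ^ θ) κ then v'
    else tcgLoop H b Δ κ θ n v' r' (r' + (‖r'‖ ^ 2 / ‖r‖ ^ 2) • p)

/-- Truncated conjugate gradients for the model with gradient `g` and Hessian operator `H`, with
at most `m` inner iterations. -/
def tcg (H : E → E) (g : E) (Δ κ θ : ℝ) (m : ℕ) : E :=
  tcgLoop H (-g) Δ κ θ m 0 (-g) (-g)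

end TCG

/-! ## The Riemannian trust-region method -/

/-- User parameters: maximum radius `Δ̄`, acceptance threshold `ρ'`, and the parameters of the
inner solver (`κ`, `θ` and the maximum number of inner iterations). -/
structure Params where
  Δbar : ℝ
  ρ' : ℝ
  κ : ℝ
  θ : ℝ
  maxInner : ℕ

namespace PoseGraph

variable {V : Type*} [Fintype V] [DecidableEq V] (G : PoseGraph V)

/-- The tentative step at `X` for the radius `Δ`. -/
def step (p : Params) (X : Amb V) (Δ : ℝ) : Amb V :=
  tcg (G.hess X) (G.grad X) Δ p.κ p.θ p.maxInner

/-- The agreement ratio `ρ` of the pullback `F ∘ Exp_X` with the model, for the step `S`. -/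
def ratio (X S : Amb V) : ℝ :=
  (G.obj (Exp X 0) - G.obj (Exp X S)) / (G.model X 0 - G.model X S)

open Classical in
/-- The radius update. -/
def nextRadius (p : Params) (X S : Amb V) (Δ : ℝ) : ℝ :=
  if G.ratio X S < 1 / 4 then 1 / 4 * Δ
  else if 3 / 4 < G.ratio X S ∧ ‖S‖ = Δ then min (2 * Δ) p.Δbar
  else Δ

open Classical in
/-- The iterate update. -/
def nextIterate (p : Params) (X S : Amb V) : Amb V :=
  if p.ρ' < G.ratio X S then Exp X S else X

/-- The iterates `(X_k, Δ_k)` of the method. The method with tolerance `ε` stops at the first `k`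
with `‖grad F(X_k)‖ ≤ ε`. -/
def rtr (p : Params) (X₀ : Amb V) (Δ₀ : ℝ) : ℕ → Amb V × ℝ
  | 0 => (X₀, Δ₀)
  | k + 1 =>
    let X := (rtr p X₀ Δ₀ k).1
    let Δ := (rtr p X₀ Δ₀ k).2
    let S := G.step p X Δ
    (G.nextIterate p X S, G.nextRadius p X S Δ)

/-- The Lipschitz-type condition at `X` for the pullback with constant `L`:
`F(Exp_X S) ≤ F(X) + Sᵀ grad F(X) + (L/2) ‖S‖²` for all tangent `S` with `‖S‖ ≤ Δ̄`. -/
def LipType (Δbar L : ℝ) (X : Amb V) : Prop :=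
  ∀ S ∈ G.tangent X, ‖S‖ ≤ Δbar →
    G.obj (Exp X S) ≤ G.obj X + inner ℝ S (G.grad X) + L / 2 * ‖S‖ ^ 2

/-- No residual reaches a relative rotation by a half turn (`r₀ = 0`, where the objective has a
kink) along the geodesic `t ↦ Exp_X(tS)`, `0 ≤ t ≤ 1`. -/
def NoHalfTurn (X S : Amb V) : Prop :=
  ∀ e ∈ G.edges, ∀ t ∈ Set.Icc (0 : ℝ) 1, G.res e (Exp X (t • S)) 0 ≠ 0

/-- The two-sided Lipschitz-type condition at `X` with constant `L`, for all tangent `S` with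
`‖S‖ ≤ Δ̄` along whose geodesic the objective is differentiable. -/
def LipTypeAbs (Δbar L : ℝ) (X : Amb V) : Prop :=
  ∀ S ∈ G.tangent X, ‖S‖ ≤ Δbar → G.NoHalfTurn X S →
    |G.obj (Exp X S) - (G.obj X + inner ℝ S (G.grad X))| ≤ L / 2 * ‖S‖ ^ 2

/-- The operator `H(X)` is bounded by `β` on unit tangent vectors. -/
def HessBound (β : ℝ) (X : Amb V) : Prop :=
  ∀ S ∈ G.tangent X, ‖S‖ = 1 → ‖G.hess X S‖ ≤ β

end PoseGraph

/-- `λ_g = ¼ min {1/β, 1/(2(L_g + β))}`. -/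
def lam (L β : ℝ) : ℝ := 1 / 4 * min (1 / β) (1 / (2 * (L + β)))

end PUDQ

end

/-!
Why the theorem is true.

*The kink.* For `r ∈ M` the half-angle satisfies `|phi r| = arccos |r₀|`, and `gam` is an even
function of it. So the logarithm map and the objective are continuous, although the half-angle jumps
at `r₀ = 0`. The contribution of an edge to the objective is `½ sinc(φ)⁻² q`, where `q ≥ 0` is a
quadratic form in the last three entries of the residual. Along a geodesic the rotational part of
the residual turns at a constant rate, and the other entries have an expansion with a second-order
remainder. The function `sinc⁻²` is analytic on `(-π, π)` and increases with the absolute value of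
the angle, so that its `π`-periodic continuation from `[-π/2, π/2]` lies below `sinc⁻²` on
`(-π, π)`: first-order upper bounds survive the kinks, and two-sided ones hold on geodesics that
avoid them (`exists_one_div_sinc_sq_taylor`, `exists_cost_expansion`). Summation over the edges
gives the Lipschitz-type conditions on bounded sets (`PoseGraph.exists_lipType`). The operator bound
holds there because `f1` is bounded on `[-π/2, π/2]` (`PoseGraph.exists_hessBound`).

*Boundedness and the minimizer.* A bound on the objective bounds every residual, because
`1 / gam ≥ 1` and the information matrices are positive definite. On a connected graph this bounds
all poses once one of them is fixed (`PoseGraph.exists_norm_blk_le`). If no vertex is anchored, one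
pose can be fixed by a left translation, which does not change the residuals. So a minimizer exists
by compactness (`PoseGraph.exists_minimizer`).

*The algorithm.* The Gauss-Newton operator is symmetric and positive semidefinite. Truncated
conjugate gradients never increase the model, and their first inner iteration already achieves the
Cauchy decrease (`tcg_spec`, `tcg_cauchy_decrease`). A radius small compared with the gradient
therefore forces a ratio of at least `1/4`; for this the one-sided Lipschitz-type condition suffices
(`PoseGraph.one_fourth_le_ratio`). So the radius never falls below `lam L β * ε` before the method
stops, every accepted step decreases the objective by a fixed amount, and every rejected one divides
the radius by `4`. A potential argument counts the iterations (`le_of_steps`).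
-/

noncomputable section

namespace PUDQ

open scoped Matrix

/-! ### The function `1 / sinc` on `(-π, π)` -/

theorem analyticAt_sinc (x : ℝ) : AnalyticAt ℝ Real.sinc x := by
  by_cases hx : x = 0
  · subst hx
    obtain ⟨p, hp⟩ : AnalyticAt ℝ Real.sin 0 := Real.analyticAt_sin
    rw [Real.sinc_eq_dslope]
    exact ⟨_, hp.has_fpower_series_dslope_fslope⟩
  · have h : AnalyticAt ℝ (fun y => Real.sin y / y) x := Real.analyticAt_sin.div analyticAt_id hx
    refine h.congr ?_
    filter_upwards [isOpen_ne.mem_nhds hx] with y hy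
    exact (Real.sinc_of_ne_zero hy).symm

theorem sinc_abs (u : ℝ) : Real.sinc |u| = Real.sinc u := by
  rcases abs_choice u with h | h <;> rw [h]
  exact Real.sinc_neg u

theorem sinc_pos {u : ℝ} (hu : |u| < Real.pi) : 0 < Real.sinc u := by
  rw [← sinc_abs]
  rcases (abs_nonneg u).eq_or_lt with h | h
  · rw [← h]; simp
  · rw [Real.sinc_of_ne_zero h.ne']
    exact div_pos (Real.sin_pos_of_pos_of_lt_pi h hu) h

/-- `sinc` decreases on `[0, π]`, because `sin` is concave there and vanishes at `0`. -/
theorem sinc_le_sinc_of_abs_le {u v : ℝ} (huv : |u| ≤ |v|) (hv : |v| < Real.pi) :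
    Real.sinc v ≤ Real.sinc u := by
  rw [← sinc_abs u, ← sinc_abs v]
  rcases (abs_nonneg u).eq_or_lt with h | h
  · rw [← h, Real.sinc_zero]; exact Real.sinc_le_one _
  · have hv0 := h.trans_le huv
    rw [Real.sinc_of_ne_zero h.ne', Real.sinc_of_ne_zero hv0.ne', div_le_div_iff₀ hv0 h]
    have hc := strictConcaveOn_sin_Icc.concaveOn.2 (Set.left_mem_Icc.2 Real.pi_pos.le)
      (show |v| ∈ Set.Icc 0 Real.pi from ⟨hv0.le, hv.le⟩)
      (sub_nonneg.2 ((div_le_one hv0).2 huv)) (div_nonneg h.le hv0.le) (by ring)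
    simp only [smul_eq_mul, mul_zero, Real.sin_zero, zero_add, div_mul_cancel₀ _ hv0.ne'] at hc
    rw [div_mul_eq_mul_div, div_le_iff₀ hv0] at hc
    linarith

theorem one_le_one_div_sinc {u : ℝ} (hu : |u| < Real.pi) : 1 ≤ 1 / Real.sinc u := by
  rw [le_div_iff₀ (sinc_pos hu), one_mul]
  exact Real.sinc_le_one u

theorem one_div_sinc_le_two {u : ℝ} (hu : |u| ≤ Real.pi / 2) : 1 / Real.sinc u ≤ 2 := by
  have hpi := Real.pi_pos
  have h : |Real.pi / 2| = Real.pi / 2 := abs_of_pos (by linarith)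
  have h1 : Real.sinc (Real.pi / 2) ≤ Real.sinc u :=
    sinc_le_sinc_of_abs_le (by rwa [h]) (by rw [h]; linarith)
  have h2 : 1 / 2 ≤ Real.sinc (Real.pi / 2) := by
    rw [Real.sinc_of_ne_zero (by linarith), Real.sin_pi_div_two,
      div_le_div_iff₀ (by norm_num) (by linarith)]
    linarith [Real.pi_le_four]
  rw [div_le_iff₀ (by linarith)]
  linarith

theorem analyticAt_one_div_sinc {u : ℝ} (hu : |u| < Real.pi) :
    AnalyticAt ℝ (fun v => 1 / Real.sinc v) u :=
  analyticAt_const.div (analyticAt_sinc u) (sinc_pos hu).ne'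

theorem hasDerivAt_one_div_sinc {u : ℝ} (hu : |u| < Real.pi) :
    HasDerivAt (fun v => 1 / Real.sinc v) (f1 u) u := by
  by_cases h0 : u = 0
  · subst h0
    -- an even differentiable function has derivative `0` at `0`
    have hd := (analyticAt_one_div_sinc hu).differentiableAt.hasDerivAt
    have hd' : HasDerivAt (fun v => 1 / Real.sinc (-v))
        (deriv (fun v => 1 / Real.sinc v) 0 * -1) 0 := by
      have := HasDerivAt.comp (h := fun v : ℝ => -v) (h₂ := fun v => 1 / Real.sinc v) (0 : ℝ)
        (by rwa [neg_zero]) (hasDerivAt_neg (0 : ℝ))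
      exact this
    simp only [Real.sinc_neg] at hd'
    have := hd.unique hd'
    have hz : deriv (fun v => 1 / Real.sinc v) 0 = 0 := by linarith
    rw [hz] at hd
    simpa [f1] using hd
  · have hs : Real.sin u ≠ 0 := by
      have := (sinc_pos hu).ne'
      rw [Real.sinc_of_ne_zero h0] at this
      exact (div_ne_zero_iff.1 this).1
    have h : HasDerivAt (fun v => v / Real.sin v) (f1 u) u := by
      have := (hasDerivAt_id' u).fun_div (Real.hasDerivAt_sin u) hs
      simpa [f1] using this
    refine h.congr_of_eventuallyEq ?_
    filter_upwards [isOpen_ne.mem_nhds h0] with y hy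
    rw [Real.sinc_of_ne_zero hy, one_div_div]

theorem exists_abs_f1_le : ∃ C : ℝ, 0 ≤ C ∧ ∀ u : ℝ, |u| ≤ Real.pi / 2 → |f1 u| ≤ C := by
  have hlt : ∀ u ∈ Set.Icc (-(Real.pi / 2)) (Real.pi / 2), |u| < Real.pi := fun u hu =>
    (abs_le.2 hu).trans_lt (by linarith [Real.pi_pos])
  have hc : ContinuousOn f1 (Set.Icc (-(Real.pi / 2)) (Real.pi / 2)) := by
    have : ContinuousOn (deriv fun v => 1 / Real.sinc v) (Set.Icc (-(Real.pi / 2)) (Real.pi / 2)) :=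
      fun u hu => (analyticAt_one_div_sinc (hlt u hu)).deriv.continuousAt.continuousWithinAt
    exact this.congr fun u hu => (hasDerivAt_one_div_sinc (hlt u hu)).deriv.symm
  obtain ⟨C, hC⟩ := isCompact_Icc.exists_bound_of_continuousOn hc
  exact ⟨max C 0, le_max_right _ _, fun u hu => (hC u (abs_le.1 hu)).trans (le_max_left _ _)⟩

theorem exists_taylor_bound {g : ℝ → ℝ} {a b : ℝ} (hg : ∀ u ∈ Set.Icc a b, AnalyticAt ℝ g u) :
    ∃ C : ℝ, 0 ≤ C ∧ ∀ x ∈ Set.Icc a b, ∀ y ∈ Set.Icc a b,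
      |g y - g x - deriv g x * (y - x)| ≤ C * (y - x) ^ 2 := by
  have hc : ContinuousOn (deriv (deriv g)) (Set.Icc a b) :=
    fun u hu => (hg u hu).deriv.deriv.continuousAt.continuousWithinAt
  obtain ⟨C, hC⟩ := isCompact_Icc.exists_bound_of_continuousOn hc
  refine ⟨max C 0, le_max_right _ _, fun x hx y hy => ?_⟩
  have hlip : ∀ t ∈ Set.Icc a b, |deriv g t - deriv g x| ≤ max C 0 * |t - x| := fun t ht =>
    (convex_Icc a b).norm_image_sub_le_of_norm_hasDerivWithin_le
      (fun u hu => (hg u hu).deriv.differentiableAt.hasDerivAt.hasDerivWithinAt)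
      (fun u hu => (hC u hu).trans (le_max_left _ _)) hx ht
  have hsub : Set.uIcc x y ⊆ Set.Icc a b := Set.uIcc_subset_Icc hx hy
  have := (convex_uIcc x y).norm_image_sub_le_of_norm_hasDerivWithin_le (𝕜 := ℝ)
    (f := fun t => g t - deriv g x * t) (f' := fun t => deriv g t - deriv g x)
    (C := max C 0 * |y - x|) (x := x) (y := y)
    (fun u hu => by
      have h1 := (hg u (hsub hu)).differentiableAt.hasDerivAt
      have h2 := (hasDerivAt_id' u).const_mul (deriv g x)
      rw [mul_one] at h2
      exact (h1.fun_sub h2).hasDerivWithinAt)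
    (fun u hu => (hlip u (hsub hu)).trans (mul_le_mul_of_nonneg_left
      (Set.abs_sub_left_of_mem_uIcc hu) (le_max_right _ _)))
    Set.left_mem_uIcc Set.right_mem_uIcc
  rw [Real.norm_eq_abs, Real.norm_eq_abs, mul_assoc, abs_mul_abs_self] at this
  calc |g y - g x - deriv g x * (y - x)|
      = |g y - deriv g x * y - (g x - deriv g x * x)| := by congr 1; ring
    _ ≤ _ := by rw [sq]; exact this

theorem deriv_one_div_sinc_sq {u : ℝ} (hu : |u| < Real.pi) :
    deriv (fun v => (1 / Real.sinc v) ^ 2) u = 2 * (1 / Real.sinc u) * f1 u := by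
  have := ((hasDerivAt_one_div_sinc hu).fun_pow 2).deriv
  simpa only [Nat.cast_ofNat, Nat.add_one_sub_one, pow_one] using this

/-- First-order expansion of `1 / sinc²`, uniform for base points `x ∈ [-π/2, π/2]`. The bound from
above also holds for the `π`-periodic continuation of `1 / sinc²` from `[-π/2, π/2]`: here `w`
stands for the representative modulo `π` (up to sign) of the angle `y`. -/
theorem exists_one_div_sinc_sq_taylor : ∃ C : ℝ, 0 ≤ C ∧ ∀ x y w : ℝ,
    |x| ≤ Real.pi / 2 → |w| ≤ Real.pi / 2 → |w| ≤ |y| →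
    (1 / Real.sinc w) ^ 2 ≤
        (1 / Real.sinc x) ^ 2 + 2 * (1 / Real.sinc x) * f1 x * (y - x) + C * (y - x) ^ 2 ∧
      (|w| = |y| → |(1 / Real.sinc w) ^ 2 -
        ((1 / Real.sinc x) ^ 2 + 2 * (1 / Real.sinc x) * f1 x * (y - x))| ≤ C * (y - x) ^ 2) := by
  have hpi := Real.pi_pos
  have hpi3 := Real.pi_gt_three
  have hlt : ∀ u ∈ Set.Icc (-(3 * Real.pi / 4)) (3 * Real.pi / 4), |u| < Real.pi := fun u hu =>
    (abs_le.2 hu).trans_lt (by linarith)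
  obtain ⟨C, hC0, hC⟩ := exists_taylor_bound (g := fun v => (1 / Real.sinc v) ^ 2)
    fun u hu => (analyticAt_one_div_sinc (hlt u hu)).pow 2
  obtain ⟨K, hK0, hK⟩ := exists_abs_f1_le
  refine ⟨C + 16 + 8 * K, by positivity, fun x y w hx hw hwy => ?_⟩
  have hx1 : |x| < Real.pi := by linarith
  have hw1 : |w| < Real.pi := by linarith
  have hmem : ∀ u : ℝ, |u| ≤ 3 * Real.pi / 4 →
      u ∈ Set.Icc (-(3 * Real.pi / 4)) (3 * Real.pi / 4) := fun u hu => abs_le.1 hu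
  have hd := deriv_one_div_sinc_sq hx1
  have hCx := fun hy => hC x (hmem x (by linarith)) y (hmem y hy)
  simp only [hd] at hCx
  have hy2 := sq_nonneg (y - x)
  have hextra : 0 ≤ (16 + 8 * K) * (y - x) ^ 2 := by positivity
  constructor
  · by_cases hxy : |y - x| ≤ Real.pi / 4
    · have hy : |y| ≤ 3 * Real.pi / 4 := by
        have := abs_add_le (y - x) x
        rw [sub_add_cancel] at this
        linarith
      have h1 := (abs_le.1 (hCx hy)).2
      have h2 : 1 / Real.sinc w ≤ 1 / Real.sinc y :=
        one_div_le_one_div_of_le (sinc_pos (by linarith))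
          (sinc_le_sinc_of_abs_le hwy (by linarith))
      have h3 : (1 / Real.sinc w) ^ 2 ≤ (1 / Real.sinc y) ^ 2 :=
        pow_le_pow_left₀ (by linarith [one_le_one_div_sinc hw1]) h2 2
      linarith
    · -- far from the base point the quadratic term dominates everything else
      push Not at hxy
      have ha : 1 / 2 ≤ |y - x| := by linarith
      have h1 := one_le_one_div_sinc hw1
      have h2 := one_div_sinc_le_two hw
      have h3 := one_le_one_div_sinc hx1
      have h4 := one_div_sinc_le_two hx
      have h5 : (1 / Real.sinc w) ^ 2 ≤ 2 ^ 2 := pow_le_pow_left₀ (by linarith) h2 2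
      have h6 : |2 * (1 / Real.sinc x) * f1 x * (y - x)| ≤ 4 * K * |y - x| := by
        rw [abs_mul, abs_mul, abs_of_pos (by linarith : 0 < 2 * (1 / Real.sinc x))]
        exact mul_le_mul_of_nonneg_right
          (mul_le_mul (by linarith) (hK x hx) (abs_nonneg _) (by norm_num)) (abs_nonneg _)
      have h7 := (abs_le.1 h6).1
      have h8 : |y - x| ≤ 2 * (y - x) ^ 2 := by
        rw [← sq_abs]; nlinarith
      have h9 : 4 * K * |y - x| ≤ 4 * K * (2 * (y - x) ^ 2) :=
        mul_le_mul_of_nonneg_left h8 (by linarith)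
      nlinarith [sq_nonneg (1 / Real.sinc x), mul_nonneg hC0 hy2]
  · intro he
    have h1 := hCx (by rw [← he]; linarith)
    have h2 : Real.sinc w = Real.sinc y := by rw [← sinc_abs w, he, sinc_abs]
    rw [h2]
    calc _ = _ := by rw [← sub_sub]
      _ ≤ _ := h1
      _ ≤ _ := by linarith

/-! ### Algebra of planar unit dual quaternions -/

theorem pudq_mul_assoc (x y z : Fin 4 → ℝ) : mul (mul x y) z = mul x (mul y z) := by
  ext i; fin_cases i <;> simp [mul] <;> ring

theorem pudq_mul_one (x : Fin 4 → ℝ) : mul x one = x := by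
  ext i; fin_cases i <;> simp [mul, one]

theorem pudq_one_mul (x : Fin 4 → ℝ) : mul one x = x := by
  ext i; fin_cases i <;> simp [mul, one]

theorem pudq_inv_mul_self {x : Fin 4 → ℝ} (hx : x ∈ M) : mul (inv x) x = one := by
  have h : x 0 ^ 2 + x 1 ^ 2 = 1 := hx
  ext i; fin_cases i <;> simp [mul, inv, one]
  · linear_combination h
  · ring
  · ring
  · ring

theorem pudq_inv_inv (x : Fin 4 → ℝ) : inv (inv x) = x := by
  ext i; fin_cases i <;> simp [inv]

theorem inv_mem {x : Fin 4 → ℝ} (hx : x ∈ M) : inv x ∈ M := by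
  have h : x 0 ^ 2 + x 1 ^ 2 = 1 := hx
  simpa [M, inv] using h

theorem pudq_mul_inv_self {x : Fin 4 → ℝ} (hx : x ∈ M) : mul x (inv x) = one := by
  simpa [pudq_inv_inv] using pudq_inv_mul_self (inv_mem hx)

theorem inv_pudq_mul (x y : Fin 4 → ℝ) : inv (mul x y) = mul (inv y) (inv x) := by
  ext i; fin_cases i <;> simp [mul, inv] <;> ring

theorem mul_mem {x y : Fin 4 → ℝ} (hx : x ∈ M) (hy : y ∈ M) : mul x y ∈ M := by
  have h : x 0 ^ 2 + x 1 ^ 2 = 1 := hx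
  have h' : y 0 ^ 2 + y 1 ^ 2 = 1 := hy
  simp only [M, mul, Set.mem_ofPred_eq, Matrix.cons_val_zero, Matrix.cons_val_one]
  linear_combination (y 0 ^ 2 + y 1 ^ 2) * h + h'

theorem pudq_mul_add (x y z : Fin 4 → ℝ) : mul x (y + z) = mul x y + mul x z := by
  ext i; fin_cases i <;> simp [mul] <;> ring

theorem pudq_add_mul (x y z : Fin 4 → ℝ) : mul (x + y) z = mul x z + mul y z := by
  ext i; fin_cases i <;> simp [mul] <;> ring

theorem pudq_mul_smul (c : ℝ) (x y : Fin 4 → ℝ) : mul x (c • y) = c • mul x y := by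
  ext i; fin_cases i <;> simp [mul] <;> ring

theorem pudq_smul_mul (c : ℝ) (x y : Fin 4 → ℝ) : mul (c • x) y = c • mul x y := by
  ext i; fin_cases i <;> simp [mul] <;> ring

theorem inv_add (x y : Fin 4 → ℝ) : inv (x + y) = inv x + inv y := by
  ext i; fin_cases i <;> simp [inv] <;> ring

theorem inv_smul (c : ℝ) (x : Fin 4 → ℝ) : inv (c • x) = c • inv x := by
  ext i; fin_cases i <;> simp [inv]

theorem tail_add (x y : Fin 4 → ℝ) : tail (x + y) = tail x + tail y := by
  ext i; fin_cases i <;> simp [tail]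

theorem tail_smul (c : ℝ) (x : Fin 4 → ℝ) : tail (c • x) = c • tail x := by
  ext i; fin_cases i <;> simp [tail]

theorem abs_apply_le {n : ℕ} (x : Fin n → ℝ) (i : Fin n) : |x i| ≤ ‖x‖ := norm_le_pi_norm x i

theorem norm_inv_le (x : Fin 4 → ℝ) : ‖inv x‖ ≤ ‖x‖ := by
  refine (pi_norm_le_iff_of_nonneg (norm_nonneg x)).2 fun i => ?_
  fin_cases i <;> simp [inv, abs_apply_le]

theorem norm_tail_le (x : Fin 4 → ℝ) : ‖tail x‖ ≤ ‖x‖ := by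
  refine (pi_norm_le_iff_of_nonneg (norm_nonneg x)).2 fun i => ?_
  fin_cases i <;> simp [tail, abs_apply_le]

theorem norm_pudq_mul_le (x y : Fin 4 → ℝ) : ‖mul x y‖ ≤ 4 * (‖x‖ * ‖y‖) := by
  have h : ∀ i j : Fin 4, |x i * y j| ≤ ‖x‖ * ‖y‖ := fun i j => by
    rw [abs_mul]
    exact mul_le_mul (abs_apply_le x i) (abs_apply_le y j) (abs_nonneg _) (norm_nonneg _)
  have h' : ∀ i j : Fin 4, -(‖x‖ * ‖y‖) ≤ x i * y j ∧ x i * y j ≤ ‖x‖ * ‖y‖ :=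
    fun i j => abs_le.1 (h i j)
  have h0 : 0 ≤ ‖x‖ * ‖y‖ := by positivity
  refine (pi_norm_le_iff_of_nonneg (by positivity)).2 fun i => ?_
  rw [Real.norm_eq_abs, abs_le]
  fin_cases i <;> simp [mul] <;> constructor <;>
    linarith [h' 0 0, h' 1 1, h' 1 0, h' 0 1, h' 2 0, h' 3 1, h' 0 2, h' 1 3, h' 3 0, h' 2 1,
      h' 1 2, h' 0 3]

/-! ### The half-angle -/

theorem abs_wrap_le {α : ℝ} (h1 : -Real.pi < α) (h2 : α ≤ Real.pi) : |wrap α| ≤ Real.pi / 2 := by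
  unfold wrap
  split_ifs <;> rw [abs_le] <;> constructor <;> linarith

theorem abs_phi_le (r : Fin 4 → ℝ) : |phi r| ≤ Real.pi / 2 :=
  abs_wrap_le (Complex.neg_pi_lt_arg _) (Complex.arg_le_pi _)

theorem abs_phi_lt_pi (r : Fin 4 → ℝ) : |phi r| < Real.pi :=
  (abs_phi_le r).trans_lt (by linarith [Real.pi_pos])

/-- Up to sign, the half-angle is a polar angle of the rotational part. -/
theorem phi_spec {r : Fin 4 → ℝ} (hr : r ∈ M) : ∃ s : ℝ, s ^ 2 = 1 ∧
    r 0 = s * Real.cos (phi r) ∧ r 1 = s * Real.sin (phi r) := by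
  have h : r 0 ^ 2 + r 1 ^ 2 = 1 := hr
  have hn : ‖(⟨r 0, r 1⟩ : ℂ)‖ = 1 := by
    rw [Complex.norm_def, Complex.normSq_mk, ← sq, ← sq, h, Real.sqrt_one]
  have hc := Complex.norm_mul_cos_arg ⟨r 0, r 1⟩
  have hs := Complex.norm_mul_sin_arg ⟨r 0, r 1⟩
  rw [hn, one_mul] at hc hs
  simp only at hc hs
  unfold phi wrap
  split_ifs
  · refine ⟨-1, by norm_num, ?_, ?_⟩
    · rw [Real.cos_add_pi, hc]; ring
    · rw [Real.sin_add_pi, hs]; ring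
  · refine ⟨-1, by norm_num, ?_, ?_⟩
    · rw [Real.cos_sub_pi, hc]; ring
    · rw [Real.sin_sub_pi, hs]; ring
  · exact ⟨1, by norm_num, by rw [hc, one_mul], by rw [hs, one_mul]⟩

theorem abs_phi_eq_arccos {r : Fin 4 → ℝ} (hr : r ∈ M) : |phi r| = Real.arccos |r 0| := by
  obtain ⟨s, hs, h0, -⟩ := phi_spec hr
  have hle := abs_phi_le r
  have hs' : |s| = 1 := by rw [← sq_eq_sq₀ (abs_nonneg _) zero_le_one, sq_abs, hs, one_pow]
  have hcos : 0 ≤ Real.cos (phi r) := Real.cos_nonneg_of_mem_Icc (abs_le.1 hle)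
  rw [h0, abs_mul, hs', one_mul, abs_of_nonneg hcos, ← Real.cos_abs,
    Real.arccos_cos (abs_nonneg _) (by linarith [Real.pi_pos])]

theorem abs_phi_eq_of_abs_le {r : Fin 4 → ℝ} (hr : r ∈ M) {ψ : ℝ} (h : |r 0| = |Real.cos ψ|)
    (hψ : |ψ| ≤ Real.pi / 2) : |phi r| = |ψ| := by
  rw [abs_phi_eq_arccos hr, h, abs_of_nonneg (Real.cos_nonneg_of_mem_Icc (abs_le.1 hψ)),
    ← Real.cos_abs, Real.arccos_cos (abs_nonneg _) (by linarith [Real.pi_pos])]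

theorem abs_phi_le_abs {r : Fin 4 → ℝ} (hr : r ∈ M) {ψ : ℝ} (h : |r 0| = |Real.cos ψ|) :
    |phi r| ≤ |ψ| := by
  rcases le_total |ψ| (Real.pi / 2) with hψ | hψ
  · exact (abs_phi_eq_of_abs_le hr h hψ).le
  · exact (abs_phi_le r).trans hψ

theorem gam_eq {r : Fin 4 → ℝ} (hr : r ∈ M) : gam r = Real.sinc (Real.arccos |r 0|) := by
  rw [gam, ← abs_phi_eq_arccos hr, sinc_abs]

theorem gam_pos (r : Fin 4 → ℝ) : 0 < gam r := sinc_pos (abs_phi_lt_pi r)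

theorem one_le_one_div_gam (r : Fin 4 → ℝ) : 1 ≤ 1 / gam r := one_le_one_div_sinc (abs_phi_lt_pi r)

theorem one_div_gam_le (r : Fin 4 → ℝ) : 1 / gam r ≤ 2 := one_div_sinc_le_two (abs_phi_le r)

/-- Although the half-angle jumps where `r₀ = 0`, the logarithm map is continuous, because it
depends on the absolute value of the half-angle only. -/
theorem continuousOn_logOne : ContinuousOn logOne M := by
  have hc : Continuous fun r : Fin 4 → ℝ => Real.sinc (Real.arccos |r 0|) :=
    Real.continuous_sinc.comp (Real.continuous_arccos.comp (continuous_apply 0).abs)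
  have ht : Continuous tail := by
    unfold tail
    refine continuous_pi fun i => ?_
    fin_cases i <;> simp <;> fun_prop
  have h : ContinuousOn (fun r => (1 / Real.sinc (Real.arccos |r 0|)) • tail r) M :=
    (continuousOn_const.div hc.continuousOn fun r hr => by
      rw [← gam_eq hr]; exact (gam_pos r).ne').smul ht.continuousOn
  exact h.congr fun r hr => by rw [logOne, gam_eq hr]

/-! ### The exponential map -/

/-- The rotation rate of the tangent vector `s` at `x`. -/
def rot (x s : Fin 4 → ℝ) : ℝ := x 0 * s 1 - x 1 * s 0

theorem rot_smul (c : ℝ) (x s : Fin 4 → ℝ) : rot x (c • s) = c * rot x s := by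
  simp [rot]; ring

theorem abs_rot_le (x s : Fin 4 → ℝ) : |rot x s| ≤ 2 * (‖x‖ * ‖s‖) := by
  have h : ∀ i j : Fin 4, |x i * s j| ≤ ‖x‖ * ‖s‖ := fun i j => by
    rw [abs_mul]
    exact mul_le_mul (abs_apply_le x i) (abs_apply_le s j) (abs_nonneg _) (norm_nonneg _)
  exact (abs_sub _ _).trans (by linarith [h 0 1, h 1 0])

theorem sinc_mul_self (u : ℝ) : Real.sinc u * u = Real.sin u := by
  by_cases h : u = 0
  · simp [h]
  · rw [Real.sinc_of_ne_zero h, div_mul_cancel₀ _ h]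

theorem expAt_zero (x s : Fin 4 → ℝ) :
    expAt x s 0 = x 0 * Real.cos (rot x s) - x 1 * Real.sin (rot x s) := by
  have h : x 0 * s 1 - x 1 * s 0 = -(x 1 * s 0) + x 0 * s 1 := by ring
  simp [expAt, mul, expOne, tail, inv, sinc_mul_self, rot, h]

theorem expAt_one (x s : Fin 4 → ℝ) :
    expAt x s 1 = x 1 * Real.cos (rot x s) + x 0 * Real.sin (rot x s) := by
  have h : x 0 * s 1 - x 1 * s 0 = -(x 1 * s 0) + x 0 * s 1 := by ring
  simp [expAt, mul, expOne, tail, inv, sinc_mul_self, rot, h]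

theorem expAt_mem {x : Fin 4 → ℝ} (hx : x ∈ M) (s : Fin 4 → ℝ) : expAt x s ∈ M := by
  have h : x 0 ^ 2 + x 1 ^ 2 = 1 := hx
  have h' := Real.sin_sq_add_cos_sq (rot x s)
  simp only [M, Set.mem_ofPred_eq]
  rw [expAt_zero, expAt_one]
  linear_combination (Real.sin (rot x s) ^ 2 + Real.cos (rot x s) ^ 2) * h + h'

theorem expAt_zero_right (x : Fin 4 → ℝ) : expAt x 0 = x := by
  have h : expOne (tail (mul (inv x) 0)) = one := by
    ext i; fin_cases i <;> simp [expOne, tail, mul, one]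
  rw [expAt, h, pudq_mul_one]

theorem abs_sinc_sub_one_le (u : ℝ) : |Real.sinc u - 1| ≤ 2 * |u| := by
  rcases le_or_gt 1 |u| with h | h
  · have := abs_le.1 (Real.abs_sinc_le_one u)
    rw [abs_le]; constructor <;> linarith
  · rw [← sinc_abs]
    rcases (abs_nonneg u).eq_or_lt with h0 | h0
    · rw [← h0]; simp
    · have h1 := Real.sin_gt_sub_cube h0
      have h2 := Real.sinc_le_one |u|
      rw [abs_le, neg_le_sub_iff_le_add]
      refine ⟨?_, by linarith⟩
      rw [Real.sinc_of_ne_zero h0.ne', ← sub_le_iff_le_add, le_div_iff₀ h0]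
      nlinarith [pow_pos h0 2, pow_le_one₀ h0.le h.le (n := 2)]

/-- The exponential map at the identity agrees with `v ↦ 1 + v` to second order. -/
theorem norm_expOne_sub_le (v : Fin 3 → ℝ) :
    ‖expOne v - (one + ![0, v 0, v 1, v 2])‖ ≤ 2 * ‖v‖ ^ 2 := by
  have hv := abs_apply_le v
  have hk : ∀ k, |Real.sinc (v 0) * v k - v k| ≤ 2 * ‖v‖ ^ 2 := fun k => by
    rw [← sub_one_mul, abs_mul]
    calc _ ≤ 2 * |v 0| * |v k| :=
          mul_le_mul_of_nonneg_right (abs_sinc_sub_one_le _) (abs_nonneg _)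
      _ ≤ 2 * ‖v‖ * ‖v‖ := by gcongr <;> exact hv _
      _ = _ := by ring
  have h0 : |Real.cos (v 0) - 1| ≤ 2 * ‖v‖ ^ 2 := by
    have h1 := Real.one_sub_sq_div_two_le_cos (x := v 0)
    have h2 := Real.cos_le_one (v 0)
    have h3 : v 0 ^ 2 ≤ ‖v‖ ^ 2 := by
      rw [← sq_abs]; exact pow_le_pow_left₀ (abs_nonneg _) (hv 0) 2
    rw [abs_le]; constructor <;> nlinarith [sq_nonneg ‖v‖]
  refine (pi_norm_le_iff_of_nonneg (by positivity)).2 fun i => ?_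
  fin_cases i <;> simp [expOne, one] <;> first | exact h0 | exact hk _

/-- The exponential map at `x` agrees with `s ↦ x + s` to second order on the tangent space. -/
theorem norm_expAt_sub_le {x s : Fin 4 → ℝ} (hx : x ∈ M) (hs : x 0 * s 0 + x 1 * s 1 = 0) :
    ‖expAt x s - (x + s)‖ ≤ 128 * (‖x‖ ^ 3 * ‖s‖ ^ 2) := by
  set v := tail (mul (inv x) s) with hv
  have hv' : ![0, v 0, v 1, v 2] = mul (inv x) s := by
    ext i; fin_cases i <;> simp [hv, tail]
    simp [mul, inv]; linarith
  have h1 : x + s = mul x (one + ![0, v 0, v 1, v 2]) := by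
    rw [pudq_mul_add, pudq_mul_one, hv', ← pudq_mul_assoc, pudq_mul_inv_self hx, pudq_one_mul]
  have h2 : expAt x s - (x + s) = mul x (expOne v - (one + ![0, v 0, v 1, v 2])) := by
    rw [h1, sub_eq_iff_eq_add, ← pudq_mul_add, sub_add_cancel, expAt]
  have h3 : ‖v‖ ≤ 4 * (‖x‖ * ‖s‖) :=
    (norm_tail_le _).trans ((norm_pudq_mul_le _ _).trans (by gcongr; exact norm_inv_le x))
  rw [h2]
  calc _ ≤ 4 * (‖x‖ * (2 * ‖v‖ ^ 2)) :=
        (norm_pudq_mul_le _ _).trans (by gcongr; exact norm_expOne_sub_le v)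
    _ ≤ 4 * (‖x‖ * (2 * (4 * (‖x‖ * ‖s‖)) ^ 2)) := by gcongr
    _ = _ := by ring

/-! ### The residual along an edge -/

/-- The residual `z⁻¹ ⊞ x⁻¹ ⊞ y`, bilinear in `(x, y)`. -/
def resid (z x y : Fin 4 → ℝ) : Fin 4 → ℝ := mul (mul (inv z) (inv x)) y

theorem resid_mem {z x y : Fin 4 → ℝ} (hz : z ∈ M) (hx : x ∈ M) (hy : y ∈ M) : resid z x y ∈ M :=
  mul_mem (mul_mem (inv_mem hz) (inv_mem hx)) hy

theorem resid_add_left (z x x' y : Fin 4 → ℝ) :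
    resid z (x + x') y = resid z x y + resid z x' y := by
  simp only [resid, inv_add, pudq_mul_add, pudq_add_mul]

theorem resid_add_right (z x y y' : Fin 4 → ℝ) :
    resid z x (y + y') = resid z x y + resid z x y' := pudq_mul_add _ _ _

theorem resid_smul_left (c : ℝ) (z x y : Fin 4 → ℝ) :
    resid z (c • x) y = c • resid z x y := by
  simp only [resid, inv_smul, pudq_mul_smul, pudq_smul_mul]

theorem resid_smul_right (c : ℝ) (z x y : Fin 4 → ℝ) :
    resid z x (c • y) = c • resid z x y := pudq_mul_smul _ _ _

theorem norm_resid_le (z x y : Fin 4 → ℝ) : ‖resid z x y‖ ≤ 16 * (‖z‖ * ‖x‖ * ‖y‖) := by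
  calc _ ≤ 4 * (‖mul (inv z) (inv x)‖ * ‖y‖) := norm_pudq_mul_le _ _
    _ ≤ 4 * ((4 * (‖z‖ * ‖x‖)) * ‖y‖) := by
      gcongr
      exact (norm_pudq_mul_le _ _).trans (by gcongr <;> exact norm_inv_le _)
    _ = _ := by ring

/-- The derivative of the residual at `(x, y)` in the direction `(s, t)`. -/
def dresid (z x y s t : Fin 4 → ℝ) : Fin 4 → ℝ := resid z s y + resid z x t

theorem norm_resid_le_of_le {z x y : Fin 4 → ℝ} {R a b : ℝ} (hz : ‖z‖ ≤ R) (hx : ‖x‖ ≤ a)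
    (hy : ‖y‖ ≤ b) : ‖resid z x y‖ ≤ 16 * (R * a * b) := by
  have := (norm_nonneg z).trans hz
  have := (norm_nonneg x).trans hx
  exact (norm_resid_le z x y).trans (by gcongr)

/-- First-order expansion of the residual along geodesics, uniform on bounded sets. -/
theorem exists_resid_expansion (R D : ℝ) (hR : 0 ≤ R) (hD : 0 ≤ D) : ∃ K : ℝ, 0 ≤ K ∧
    ∀ (z x y s t : Fin 4 → ℝ) (σ : ℝ), x ∈ M → y ∈ M → ‖z‖ ≤ R → ‖x‖ ≤ R → ‖y‖ ≤ R →
      x 0 * s 0 + x 1 * s 1 = 0 → y 0 * t 0 + y 1 * t 1 = 0 → ‖s‖ ≤ σ → ‖t‖ ≤ σ → σ ≤ D →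
      ‖resid z x y‖ ≤ K ∧ ‖dresid z x y s t‖ ≤ K * σ ∧
        ‖resid z (expAt x s) (expAt y t) - (resid z x y + dresid z x y s t)‖ ≤ K * σ ^ 2 := by
  set A := 128 * R ^ 3 with hA
  have hA0 : 0 ≤ A := by positivity
  set K := 16 * (R * R * R) + 32 * (R * R) + 16 * R * (2 * A * R + (1 + A * D) ^ 2) with hK
  have h1 : 0 ≤ 16 * (R * R * R) := by positivity
  have h2 : 0 ≤ 32 * (R * R) := by positivity
  have h3 : 0 ≤ 16 * R * (2 * A * R + (1 + A * D) ^ 2) := by positivity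
  refine ⟨K, by positivity, fun z x y s t σ hxM hyM hz hx hy hs ht hsσ htσ hσ => ?_⟩
  have hσ0 : 0 ≤ σ := (norm_nonneg s).trans hsσ
  set ρ := expAt x s - (x + s) with hρ
  set τ := expAt y t - (y + t) with hτ
  have hρn : ‖ρ‖ ≤ A * σ ^ 2 := (norm_expAt_sub_le hxM hs).trans (by
    rw [hA, mul_assoc]; gcongr)
  have hτn : ‖τ‖ ≤ A * σ ^ 2 := (norm_expAt_sub_le hyM ht).trans (by
    rw [hA, mul_assoc]; gcongr)
  have hle : ∀ {u v : Fin 4 → ℝ}, ‖u‖ ≤ σ → ‖v‖ ≤ A * σ ^ 2 → ‖u + v‖ ≤ (1 + A * D) * σ :=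
    fun {u v} hu hv => (norm_add_le _ _).trans (by
      have : A * σ ^ 2 ≤ A * D * σ := by
        rw [sq, ← mul_assoc]; gcongr
      linarith)
  refine ⟨(norm_resid_le_of_le hz hx hy).trans (by linarith), ?_, ?_⟩
  · calc _ ≤ 16 * (R * σ * R) + 16 * (R * R * σ) :=
          (norm_add_le _ _).trans (add_le_add (norm_resid_le_of_le hz hsσ hy)
            (norm_resid_le_of_le hz hx htσ))
      _ = 32 * (R * R) * σ := by ring
      _ ≤ _ := by gcongr; linarith
  · have hx' : expAt x s = x + (s + ρ) := by rw [hρ]; abel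
    have hy' : expAt y t = y + (t + τ) := by rw [hτ]; abel
    have hexp : resid z (expAt x s) (expAt y t) - (resid z x y + dresid z x y s t) =
        resid z ρ y + resid z x τ + resid z (s + ρ) (t + τ) := by
      rw [hx', hy']
      simp only [resid_add_left, resid_add_right, dresid]
      abel
    rw [hexp]
    calc _ ≤ 16 * (R * (A * σ ^ 2) * R) + 16 * (R * R * (A * σ ^ 2)) +
            16 * (R * ((1 + A * D) * σ) * ((1 + A * D) * σ)) :=
          (norm_add_le _ _).trans (add_le_add ((norm_add_le _ _).trans
            (add_le_add (norm_resid_le_of_le hz hρn hy) (norm_resid_le_of_le hz hx hτn)))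
            (norm_resid_le_of_le hz (hle hsσ hρn) (hle htσ hτn)))
      _ = 16 * R * (2 * A * R + (1 + A * D) ^ 2) * σ ^ 2 := by ring
      _ ≤ _ := by gcongr; linarith

/-- Along geodesics the rotational part of the residual turns at the constant rate
`rot y t - rot x s`. -/
theorem resid_expAt_zero (z x y s t : Fin 4 → ℝ) : resid z (expAt x s) (expAt y t) 0 =
    resid z x y 0 * Real.cos (rot y t - rot x s) -
      resid z x y 1 * Real.sin (rot y t - rot x s) := by
  rw [Real.cos_sub, Real.sin_sub]
  simp [resid, mul, inv, expAt_zero, expAt_one]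
  ring

theorem rot_resid_dresid {z x y : Fin 4 → ℝ} (hz : z ∈ M) (hx : x ∈ M) (hy : y ∈ M)
    (s t : Fin 4 → ℝ) :
    resid z x y 0 * dresid z x y s t 1 - resid z x y 1 * dresid z x y s t 0 =
      rot y t - rot x s := by
  have hz' : z 0 ^ 2 + z 1 ^ 2 = 1 := hz
  have hx' : x 0 ^ 2 + x 1 ^ 2 = 1 := hx
  have hy' : y 0 ^ 2 + y 1 ^ 2 = 1 := hy
  have h : resid z x y 0 * dresid z x y s t 1 - resid z x y 1 * dresid z x y s t 0 =
      (z 0 ^ 2 + z 1 ^ 2) * ((x 0 ^ 2 + x 1 ^ 2) * rot y t - (y 0 ^ 2 + y 1 ^ 2) * rot x s) := by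
    simp [resid, dresid, mul, inv, rot]
    ring
  rw [h, hz', hx', hy']
  ring

/-! ### The objective along an edge -/

theorem abs_dotProduct_mulVec_le (Ω : Matrix (Fin 3) (Fin 3) ℝ) (u v : Fin 3 → ℝ) :
    |u ⬝ᵥ (Ω *ᵥ v)| ≤ (∑ i, ∑ j, |Ω i j|) * (‖u‖ * ‖v‖) := by
  simp only [dotProduct, Matrix.mulVec, Finset.mul_sum, Finset.sum_mul]
  refine (Finset.abs_sum_le_sum_abs _ _).trans (Finset.sum_le_sum fun i _ => ?_)
  refine (Finset.abs_sum_le_sum_abs _ _).trans (Finset.sum_le_sum fun j _ => ?_)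
  rw [abs_mul, abs_mul]
  calc |u i| * (|Ω i j| * |v j|) ≤ ‖u‖ * (|Ω i j| * ‖v‖) := by
        gcongr
        · exact abs_apply_le u i
        · exact abs_apply_le v j
    _ = _ := by ring

theorem dotProduct_mulVec_comm {Ω : Matrix (Fin 3) (Fin 3) ℝ} (hΩ : Ω.IsSymm) (u v : Fin 3 → ℝ) :
    u ⬝ᵥ (Ω *ᵥ v) = v ⬝ᵥ (Ω *ᵥ u) := by
  rw [Matrix.dotProduct_mulVec, ← Matrix.mulVec_transpose, hΩ.eq, dotProduct_comm]

/-- The product of two first-order expansions, up to a second-order remainder with a uniform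
constant. -/
theorem exists_product_expansion (Γ K D : ℝ) (hΓ : 0 ≤ Γ) (hK : 0 ≤ K) (hD : 0 ≤ D) :
    ∃ C : ℝ, 0 ≤ C ∧ ∀ G₀ γ ω q₀ q' η σ : ℝ, 0 ≤ σ → σ ≤ D → |G₀| ≤ Γ → |γ| ≤ Γ → |ω| ≤ K * σ →
      |q'| ≤ K * σ → |η| ≤ K * σ ^ 2 →
      |(G₀ + γ * ω) * (q₀ + q' + η) - (G₀ * q₀ + γ * ω * q₀ + G₀ * q')| ≤ C * σ ^ 2 := by
  refine ⟨Γ * K * K + (Γ + Γ * (K * D)) * K, by positivity,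
    fun G₀ γ ω q₀ q' η σ hσ hσD hG hγ hω hq hη => ?_⟩
  have h : (G₀ + γ * ω) * (q₀ + q' + η) - (G₀ * q₀ + γ * ω * q₀ + G₀ * q') =
      γ * ω * q' + (G₀ + γ * ω) * η := by ring
  rw [h]
  have h1 : |γ * ω * q'| ≤ Γ * (K * σ) * (K * σ) := by
    rw [abs_mul, abs_mul]; gcongr
  have h2 : |G₀ + γ * ω| ≤ Γ + Γ * (K * D) := by
    refine (abs_add_le _ _).trans (add_le_add hG ?_)
    rw [abs_mul]
    exact mul_le_mul hγ (hω.trans (by gcongr)) (abs_nonneg _) hΓ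
  calc _ ≤ Γ * (K * σ) * (K * σ) + (Γ + Γ * (K * D)) * (K * σ ^ 2) := by
        refine (abs_add_le _ _).trans (add_le_add h1 ?_)
        rw [abs_mul]
        exact mul_le_mul h2 hη (abs_nonneg _) (by positivity)
    _ = _ := by ring

/-- Along a path of angles that never reaches a half turn modulo `π`, the endpoint stays in
`(-π/2, π/2)`. -/
theorem abs_lt_pi_div_two_of_cos_ne_zero {a ω : ℝ} (ha : |a| ≤ Real.pi / 2)
    (h : ∀ τ ∈ Set.Icc (0 : ℝ) 1, Real.cos (a + τ * ω) ≠ 0) : |a + ω| < Real.pi / 2 := by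
  by_contra! hc
  have hcont : ContinuousOn (fun τ : ℝ => |a + τ * ω|) (Set.Icc 0 1) := by fun_prop
  obtain ⟨τ, hτ, he⟩ := intermediate_value_Icc zero_le_one hcont
    (show Real.pi / 2 ∈ Set.Icc |a + 0 * ω| |a + 1 * ω| by simpa using ⟨ha, hc⟩)
  apply h τ hτ
  rw [← Real.cos_abs]
  simp only at he
  rw [he, Real.cos_pi_div_two]

/-- The contribution `½ eᵀ Ω e`, `e = Log₁ r`, of an edge to the objective. -/
def cost (Ω : Matrix (Fin 3) (Fin 3) ℝ) (r : Fin 4 → ℝ) : ℝ :=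
  1 / 2 * (logOne r ⬝ᵥ (Ω *ᵥ logOne r))

theorem cost_eq (Ω : Matrix (Fin 3) (Fin 3) ℝ) (r : Fin 4 → ℝ) :
    cost Ω r = 1 / 2 * ((1 / gam r) ^ 2 * (tail r ⬝ᵥ (Ω *ᵥ tail r))) := by
  simp only [cost, logOne, Matrix.mulVec_smul, smul_dotProduct, dotProduct_smul, smul_eq_mul]
  ring

theorem exists_quadForm_expansion {Ω : Matrix (Fin 3) (Fin 3) ℝ} (hΩ : Ω.PosDef) (K D : ℝ)
    (hK : 0 ≤ K) (hD : 0 ≤ D) : ∃ C : ℝ, 0 ≤ C ∧ ∀ (r dr r' : Fin 4 → ℝ) (σ : ℝ), 0 ≤ σ → σ ≤ D →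
      ‖r‖ ≤ K → ‖dr‖ ≤ K * σ → ‖r' - (r + dr)‖ ≤ K * σ ^ 2 →
      |2 * (tail dr ⬝ᵥ (Ω *ᵥ tail r))| ≤ C * σ ∧
      |tail r' ⬝ᵥ (Ω *ᵥ tail r') - tail r ⬝ᵥ (Ω *ᵥ tail r) - 2 * (tail dr ⬝ᵥ (Ω *ᵥ tail r))| ≤
        C * σ ^ 2 ∧
      0 ≤ tail r' ⬝ᵥ (Ω *ᵥ tail r') ∧ tail r' ⬝ᵥ (Ω *ᵥ tail r') ≤ C := by
  set B := ∑ i, ∑ j, |Ω i j| with hB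
  have hB0 : 0 ≤ B := by positivity
  have hc1 : 0 ≤ 2 * (B * (K * K)) := by positivity
  have hc2 : 0 ≤ B * (K * K) + 2 * (B * (K * K)) + 2 * (B * (K * D * K)) + B * (K * D) ^ 2 := by
    positivity
  have hc3 : 0 ≤ B * (K + K * D + K * D ^ 2) ^ 2 := by positivity
  refine ⟨2 * (B * (K * K)) + (B * (K * K) + 2 * (B * (K * K)) + 2 * (B * (K * D * K)) +
    B * (K * D) ^ 2) + B * (K + K * D + K * D ^ 2) ^ 2, by positivity,
    fun r dr r' σ hσ0 hσ hr hdr hrem => ?_⟩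
  have hsymm : Ω.IsSymm := by
    have := hΩ.isHermitian
    rwa [Matrix.IsHermitian, Matrix.conjTranspose_eq_transpose_of_trivial] at this
  have hbound : ∀ {u v : Fin 4 → ℝ} {p q : ℝ}, ‖u‖ ≤ p → ‖v‖ ≤ q →
      |tail u ⬝ᵥ (Ω *ᵥ tail v)| ≤ B * (p * q) := fun {u v p q} hu hv => by
    have hp := (norm_nonneg u).trans hu
    refine (abs_dotProduct_mulVec_le Ω _ _).trans ?_
    gcongr
    · exact (norm_tail_le u).trans hu
    · exact (norm_tail_le v).trans hv
  have hr'n : ‖r'‖ ≤ K + K * D + K * D ^ 2 := by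
    have h1 : K * σ ≤ K * D := by gcongr
    have h2 : K * σ ^ 2 ≤ K * D ^ 2 := by gcongr
    calc ‖r'‖ = ‖r + dr + (r' - (r + dr))‖ := by rw [add_sub_cancel]
      _ ≤ ‖r‖ + ‖dr‖ + ‖r' - (r + dr)‖ := norm_add₃_le
      _ ≤ _ := by linarith
  refine ⟨?_, ?_, ?_, ?_⟩
  · rw [abs_mul, abs_two]
    calc _ ≤ 2 * (B * (K * σ * K)) := by linarith [hbound hdr hr]
      _ = 2 * (B * (K * K)) * σ := by ring
      _ ≤ _ := by gcongr; linarith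
  · have hexp : tail r' ⬝ᵥ (Ω *ᵥ tail r') - tail r ⬝ᵥ (Ω *ᵥ tail r) -
        2 * (tail dr ⬝ᵥ (Ω *ᵥ tail r)) =
        tail dr ⬝ᵥ (Ω *ᵥ tail dr) + 2 * (tail (r' - (r + dr)) ⬝ᵥ (Ω *ᵥ tail r)) +
          2 * (tail (r' - (r + dr)) ⬝ᵥ (Ω *ᵥ tail dr)) +
          tail (r' - (r + dr)) ⬝ᵥ (Ω *ᵥ tail (r' - (r + dr))) := by
      have h : tail r' = tail r + tail dr + tail (r' - (r + dr)) := by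
        rw [← tail_add, ← tail_add, add_sub_cancel]
      rw [h]
      simp only [Matrix.mulVec_add, add_dotProduct, dotProduct_add]
      rw [dotProduct_mulVec_comm hsymm (tail r) (tail dr),
        dotProduct_mulVec_comm hsymm (tail r) (tail (r' - (r + dr))),
        dotProduct_mulVec_comm hsymm (tail dr) (tail (r' - (r + dr)))]
      ring
    rw [hexp]
    have h1 := abs_le.1 (hbound hdr hdr)
    have h2 := abs_le.1 (hbound hrem hr)
    have h3 := abs_le.1 (hbound hrem hdr)
    have h4 := abs_le.1 (hbound hrem hrem)
    have e1 : B * (K * σ * (K * σ)) = B * (K * K) * σ ^ 2 := by ring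
    have e2 : B * (K * σ ^ 2 * K) = B * (K * K) * σ ^ 2 := by ring
    have e3 : B * (K * σ ^ 2 * (K * σ)) ≤ B * (K * D * K) * σ ^ 2 := by
      calc _ = B * (K * σ * K) * σ ^ 2 := by ring
        _ ≤ _ := by gcongr
    have e4 : B * (K * σ ^ 2 * (K * σ ^ 2)) ≤ B * (K * D) ^ 2 * σ ^ 2 := by
      calc _ = B * (K * σ) ^ 2 * σ ^ 2 := by ring
        _ ≤ _ := by gcongr
    rw [e1] at h1
    rw [e2] at h2
    calc _ ≤ (B * (K * K) + 2 * (B * (K * K)) + 2 * (B * (K * D * K)) + B * (K * D) ^ 2) *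
          σ ^ 2 := by
          rw [abs_le]
          constructor <;> linarith [h1.1, h1.2, h2.1, h2.2, h3.1, h3.2, h4.1, h4.2]
      _ ≤ _ := mul_le_mul_of_nonneg_right (by linarith) (sq_nonneg σ)
  · simpa using hΩ.posSemidef.dotProduct_mulVec_nonneg (tail r')
  · refine (le_abs_self _).trans ((hbound hr'n hr'n).trans ?_)
    rw [← sq]
    linarith

/-- First-order expansion of the contribution of an edge along geodesics, uniform on bounded sets.
At a half turn the contribution is locally a minimum of two smooth functions, and `dLogOne` is the
derivative of one of the two branches, so that the bound from above persists there. -/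
theorem exists_cost_expansion {Ω : Matrix (Fin 3) (Fin 3) ℝ} (hΩ : Ω.PosDef) (R D : ℝ)
    (hR : 0 ≤ R) (hD : 0 ≤ D) : ∃ C : ℝ, 0 ≤ C ∧
    ∀ (z x y s t : Fin 4 → ℝ) (σ : ℝ), z ∈ M → x ∈ M → y ∈ M → ‖z‖ ≤ R → ‖x‖ ≤ R → ‖y‖ ≤ R →
      x 0 * s 0 + x 1 * s 1 = 0 → y 0 * t 0 + y 1 * t 1 = 0 → ‖s‖ ≤ σ → ‖t‖ ≤ σ → σ ≤ D →
      cost Ω (resid z (expAt x s) (expAt y t)) ≤ cost Ω (resid z x y) +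
          dLogOne (resid z x y) (dresid z x y s t) ⬝ᵥ (Ω *ᵥ logOne (resid z x y)) + C * σ ^ 2 ∧
      ((∀ τ ∈ Set.Icc (0 : ℝ) 1, resid z (expAt x (τ • s)) (expAt y (τ • t)) 0 ≠ 0) →
        |cost Ω (resid z (expAt x s) (expAt y t)) - (cost Ω (resid z x y) +
          dLogOne (resid z x y) (dresid z x y s t) ⬝ᵥ (Ω *ᵥ logOne (resid z x y)))| ≤
          C * σ ^ 2) := by
  obtain ⟨K, hK0, hK⟩ := exists_resid_expansion R D hR hD
  obtain ⟨Q, hQ0, hQ⟩ := exists_quadForm_expansion hΩ K D hK0 hD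
  obtain ⟨T, hT0, hT⟩ := exists_one_div_sinc_sq_taylor
  obtain ⟨F, hF0, hF⟩ := exists_abs_f1_le
  have hRQ : 0 ≤ 4 * R + Q := by positivity
  obtain ⟨P, hP0, hP⟩ := exists_product_expansion (4 + 4 * F) (4 * R + Q) D (by positivity) hRQ hD
  refine ⟨P + T * (4 * R + Q) ^ 2 * Q, by positivity,
    fun z x y s t σ hzM hxM hyM hz hx hy hs ht hsσ htσ hσ => ?_⟩
  have hσ0 : 0 ≤ σ := (norm_nonneg s).trans hsσ
  obtain ⟨hr, hdr, hrem⟩ := hK z x y s t σ hxM hyM hz hx hy hs ht hsσ htσ hσ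
  have hrM := resid_mem hzM hxM hyM
  have hr1M := resid_mem hzM (expAt_mem hxM s) (expAt_mem hyM t)
  have hrot := rot_resid_dresid hzM hxM hyM s t
  have hcos : ∀ τ : ℝ, |resid z (expAt x (τ • s)) (expAt y (τ • t)) 0| =
      |Real.cos (phi (resid z x y) + τ * (rot y t - rot x s))| := fun τ => by
    obtain ⟨ε, hε, h0, h1⟩ := phi_spec hrM
    have hε' : |ε| = 1 := by rw [← sq_eq_sq₀ (abs_nonneg _) zero_le_one, sq_abs, hε, one_pow]
    rw [resid_expAt_zero, rot_smul, rot_smul, ← mul_sub, h0, h1, mul_assoc, mul_assoc, ← mul_sub,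
      ← Real.cos_add, abs_mul, hε', one_mul]
  have hω : |rot y t - rot x s| ≤ (4 * R + Q) * σ := by
    have h1 : |rot y t| ≤ 2 * (R * σ) := (abs_rot_le y t).trans (by gcongr)
    have h2 : |rot x s| ≤ 2 * (R * σ) := (abs_rot_le x s).trans (by gcongr)
    have h3 : 0 ≤ Q * σ := by positivity
    exact (abs_sub _ _).trans (by linarith)
  have hcos1 := hcos 1
  simp only [one_smul, one_mul] at hcos1
  obtain ⟨hq'le, hηle, hq1nn, hq1le⟩ := hQ _ _ _ σ hσ0 hσ hr hdr hrem
  generalize resid z x y = r at *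
  generalize dresid z x y s t = dr at *
  generalize resid z (expAt x s) (expAt y t) = r1 at *
  generalize rot y t - rot x s = ω at *
  -- the scalar factor
  have hφ := abs_phi_le r
  have hg1 := one_le_one_div_gam r
  have hg2 := one_div_gam_le r
  have hfr := hF _ hφ
  have hG0 : |(1 / gam r) ^ 2| ≤ 4 + 4 * F := by
    rw [abs_of_nonneg (sq_nonneg _)]
    nlinarith
  have hγ : |2 * (1 / gam r) * f1 (phi r)| ≤ 4 + 4 * F := by
    rw [abs_mul, abs_of_pos (by linarith : 0 < 2 * (1 / gam r))]
    nlinarith [abs_nonneg (f1 (phi r))]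
  have hR4 : 0 ≤ 4 * R * σ := by positivity
  have hR4' : 0 ≤ 4 * R * σ ^ 2 := by positivity
  have hprod := hP _ _ ω (tail r ⬝ᵥ (Ω *ᵥ tail r)) _ _ σ hσ0 hσ hG0 hγ hω
    (hq'le.trans (by linarith)) (hηle.trans (by linarith))
  rw [sub_sub, add_sub_cancel] at hprod
  have hTω : T * ω ^ 2 ≤ T * (4 * R + Q) ^ 2 * σ ^ 2 := by
    have : ω ^ 2 ≤ ((4 * R + Q) * σ) ^ 2 := by rw [← sq_abs]; gcongr
    calc _ ≤ T * ((4 * R + Q) * σ) ^ 2 := by gcongr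
      _ = _ := by ring
  obtain ⟨htay, htay2⟩ := hT (phi r) (phi r + ω) (phi r1) hφ (abs_phi_le r1)
    (abs_phi_le_abs hr1M hcos1)
  rw [add_sub_cancel_left] at htay htay2
  change (1 / gam r1) ^ 2 ≤ (1 / gam r) ^ 2 + 2 * (1 / gam r) * f1 (phi r) * ω + T * ω ^ 2 at htay
  change _ → |(1 / gam r1) ^ 2 - ((1 / gam r) ^ 2 + 2 * (1 / gam r) * f1 (phi r) * ω)| ≤ T * ω ^ 2
    at htay2
  -- the linear term
  have hlin : dLogOne r dr ⬝ᵥ (Ω *ᵥ logOne r) = 1 / 2 *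
      ((1 / gam r) ^ 2 * (2 * (tail dr ⬝ᵥ (Ω *ᵥ tail r))) +
        2 * (1 / gam r) * f1 (phi r) * ω * (tail r ⬝ᵥ (Ω *ᵥ tail r))) := by
    have hn : r 0 ^ 2 + r 1 ^ 2 = 1 := hrM
    simp only [dLogOne, logOne, Matrix.mulVec_smul, add_dotProduct, smul_dotProduct,
      dotProduct_smul, smul_eq_mul, hrot, hn, div_one]
    ring
  rw [hlin, cost_eq, cost_eq]
  have hTQ : T * ω ^ 2 * (tail r1 ⬝ᵥ (Ω *ᵥ tail r1)) ≤ T * (4 * R + Q) ^ 2 * Q * σ ^ 2 := by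
    calc _ ≤ (T * (4 * R + Q) ^ 2 * σ ^ 2) * Q := mul_le_mul hTω hq1le hq1nn (by positivity)
      _ = _ := by ring
  have hTQ0 : 0 ≤ T * (4 * R + Q) ^ 2 * Q * σ ^ 2 := by positivity
  have hPσ : 0 ≤ P * σ ^ 2 := by positivity
  have hφω : (∀ τ ∈ Set.Icc (0 : ℝ) 1, resid z (expAt x (τ • s)) (expAt y (τ • t)) 0 ≠ 0) →
      |phi r + ω| < Real.pi / 2 := fun hne =>
    abs_lt_pi_div_two_of_cos_ne_zero hφ fun τ hτ h0 => by
      have := hcos τ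
      rw [h0, abs_zero, abs_eq_zero] at this
      exact hne τ hτ this
  replace htay2 := fun hne => htay2 (abs_phi_eq_of_abs_le hr1M hcos1 (hφω hne).le)
  generalize tail r1 ⬝ᵥ (Ω *ᵥ tail r1) = q1 at *
  generalize tail r ⬝ᵥ (Ω *ᵥ tail r) = q₀ at *
  generalize 2 * (tail dr ⬝ᵥ (Ω *ᵥ tail r)) = q' at *
  generalize 2 * (1 / gam r) * f1 (phi r) = γ at *
  generalize (1 / gam r) ^ 2 = G₀ at *
  generalize (1 / gam r1) ^ 2 = G₁ at *
  rw [add_mul]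
  generalize T * (4 * R + Q) ^ 2 * Q * σ ^ 2 = c₁ at *
  generalize P * σ ^ 2 = c₂ at *
  have h2 := abs_le.1 hprod
  constructor
  · have h1 := mul_le_mul_of_nonneg_right htay hq1nn
    linarith [h2.1, h2.2]
  · intro hne
    have h1 : |(G₁ - (G₀ + γ * ω)) * q1| ≤ T * ω ^ 2 * q1 := by
      rw [abs_mul, abs_of_nonneg hq1nn]
      exact mul_le_mul_of_nonneg_right (htay2 hne) hq1nn
    rw [sub_mul, abs_le] at h1
    rw [abs_le]
    constructor <;> linarith [h1.1, h1.2, h2.1, h2.2]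

/-! ### Truncated conjugate gradients -/

section TruncatedCG

variable {E : Type*} [NormedAddCommGroup E] [InnerProductSpace ℝ E]

/-- The quadratic `½⟨v, Hv⟩ - ⟨b, v⟩` that truncated conjugate gradients minimize. -/
def quad (H : E →ₗ[ℝ] E) (b v : E) : ℝ := 1 / 2 * inner ℝ v (H v) - inner ℝ b v

theorem quad_add_smul {H : E →ₗ[ℝ] E} (hH : H.IsSymmetric) (b v p : E) (t : ℝ) :
    quad H b (v + t • p) =
      quad H b v - t * inner ℝ (b - H v) p + 1 / 2 * t ^ 2 * inner ℝ p (H p) := by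
  have h1 : inner ℝ v (H p) = inner ℝ (H v) p := (hH v p).symm
  have h2 : inner ℝ p (H v) = inner ℝ (H v) p := real_inner_comm _ _
  simp only [quad, map_add, map_smul, inner_add_left, inner_add_right, inner_smul_left,
    inner_smul_right, inner_sub_left, h1, h2, RCLike.conj_to_real]
  ring

omit [InnerProductSpace ℝ E] in
theorem toBoundary_sq_nonneg {Δ : ℝ} {v : E} (hv : ‖v‖ ≤ Δ) : 0 ≤ Δ ^ 2 - ‖v‖ ^ 2 :=
  sub_nonneg.2 (pow_le_pow_left₀ (norm_nonneg v) hv 2)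

theorem abs_inner_le_sqrt_toBoundary {Δ : ℝ} {v : E} (hv : ‖v‖ ≤ Δ) (p : E) :
    |inner ℝ v p| ≤ Real.sqrt (inner ℝ v p ^ 2 + ‖p‖ ^ 2 * (Δ ^ 2 - ‖v‖ ^ 2)) := by
  apply Real.abs_le_sqrt
  have := mul_nonneg (sq_nonneg ‖p‖) (toBoundary_sq_nonneg hv)
  linarith

theorem toBoundary_nonneg {Δ : ℝ} {v : E} (hv : ‖v‖ ≤ Δ) (p : E) : 0 ≤ toBoundary Δ v p := by
  refine div_nonneg ?_ (sq_nonneg _)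
  linarith [abs_inner_le_sqrt_toBoundary hv p, le_abs_self (inner ℝ v p)]

theorem norm_add_smul_sq (v p : E) (t : ℝ) :
    ‖v + t • p‖ ^ 2 = ‖v‖ ^ 2 + 2 * t * inner ℝ v p + t ^ 2 * ‖p‖ ^ 2 := by
  rw [norm_add_sq_real, inner_smul_right, norm_smul, mul_pow, Real.norm_eq_abs, sq_abs]
  ring

theorem norm_add_toBoundary_smul {Δ : ℝ} {v p : E} (hv : ‖v‖ ≤ Δ) (hp : p ≠ 0) :
    ‖v + toBoundary Δ v p • p‖ = Δ := by
  have hΔ : 0 ≤ Δ := (norm_nonneg v).trans hv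
  have hP : ‖p‖ ^ 2 ≠ 0 := pow_ne_zero 2 (norm_ne_zero_iff.2 hp)
  have hs := Real.sq_sqrt (add_nonneg (sq_nonneg (inner ℝ v p))
    (mul_nonneg (sq_nonneg ‖p‖) (toBoundary_sq_nonneg hv)))
  have ht : toBoundary Δ v p * ‖p‖ ^ 2 + inner ℝ v p =
      Real.sqrt (inner ℝ v p ^ 2 + ‖p‖ ^ 2 * (Δ ^ 2 - ‖v‖ ^ 2)) := by
    rw [toBoundary, div_mul_cancel₀ _ hP]; ring
  rw [← ht] at hs
  have : ‖v + toBoundary Δ v p • p‖ ^ 2 = Δ ^ 2 := by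
    rw [norm_add_smul_sq]
    apply mul_left_cancel₀ hP
    linear_combination hs
  exact (pow_left_inj₀ (norm_nonneg _) hΔ two_ne_zero).1 this

theorem norm_add_toBoundary_smul_le {Δ : ℝ} {v : E} (hv : ‖v‖ ≤ Δ) (p : E) :
    ‖v + toBoundary Δ v p • p‖ ≤ Δ := by
  by_cases hp : p = 0
  · simpa [hp] using hv
  · exact (norm_add_toBoundary_smul hv hp).le

/-- The boundary is reached no later than any step that leaves the trust region. -/
theorem toBoundary_le {Δ : ℝ} {v p : E} (hv : ‖v‖ ≤ Δ) (hp : p ≠ 0) {t : ℝ} (ht : 0 < t)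
    (h : Δ ≤ ‖v + t • p‖) : toBoundary Δ v p ≤ t := by
  have hΔ : 0 ≤ Δ := (norm_nonneg v).trans hv
  have hP : 0 < ‖p‖ ^ 2 := pow_pos (norm_pos_iff.2 hp) 2
  have h2 := pow_le_pow_left₀ hΔ h 2
  rw [norm_add_smul_sq] at h2
  have hle := abs_inner_le_sqrt_toBoundary hv p
  have hab : Real.sqrt (inner ℝ v p ^ 2 + ‖p‖ ^ 2 * (Δ ^ 2 - ‖v‖ ^ 2)) ≤
      |‖p‖ ^ 2 * t + inner ℝ v p| := by
    rw [← Real.sqrt_sq_eq_abs]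
    apply Real.sqrt_le_sqrt
    nlinarith [mul_le_mul_of_nonneg_left h2 hP.le]
  rw [toBoundary, div_le_iff₀ hP]
  have hpt := mul_pos hP ht
  rcases abs_cases (‖p‖ ^ 2 * t + inner ℝ v p) with ⟨h', _⟩ | ⟨h', _⟩
  · linarith
  · -- the other root of the quadratic is nonpositive
    linarith [neg_abs_le (inner ℝ v p)]

/-- A step to the boundary lowers the quadratic by at least half of the linear decrease. -/
theorem quad_add_toBoundary_le {H : E →ₗ[ℝ] E} (hH : H.IsSymmetric) {b v p : E} {Δ : ℝ}
    (hv : ‖v‖ ≤ Δ) (hrp : inner ℝ (b - H v) p = ‖b - H v‖ ^ 2) (hp0 : b - H v = 0 → p = 0)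
    (hexit : inner ℝ p (H p) ≤ 0 ∨ Δ ≤ ‖v + (‖b - H v‖ ^ 2 / inner ℝ p (H p)) • p‖) :
    quad H b (v + toBoundary Δ v p • p) ≤
      quad H b v - 1 / 2 * (toBoundary Δ v p * ‖b - H v‖ ^ 2) := by
  have hτ := toBoundary_nonneg hv p
  rw [quad_add_smul hH, hrp]
  have hr := sq_nonneg ‖b - H v‖
  have key : toBoundary Δ v p * inner ℝ p (H p) ≤ ‖b - H v‖ ^ 2 := by
    by_cases hp : inner ℝ p (H p) ≤ 0
    · exact (mul_nonpos_of_nonneg_of_nonpos hτ hp).trans hr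
    · have hp' := not_le.1 hp
      have hpne : p ≠ 0 := by rintro rfl; simp at hp'
      have h0 : 0 < ‖b - H v‖ ^ 2 := pow_pos (norm_pos_iff.2 fun h => hpne (hp0 h)) 2
      exact (le_div_iff₀ hp').1 (toBoundary_le hv hpne (div_pos h0 hp') (hexit.resolve_left hp))
  linarith [mul_le_mul_of_nonneg_left key hτ]

/-- Along a direction of positive curvature, the conjugate gradient step is an exact line search. -/
theorem quad_add_cg_step {H : E →ₗ[ℝ] E} (hH : H.IsSymmetric) {b v p : E}
    (hrp : inner ℝ (b - H v) p = ‖b - H v‖ ^ 2) (hp : 0 < inner ℝ p (H p)) :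
    quad H b (v + (‖b - H v‖ ^ 2 / inner ℝ p (H p)) • p) =
      quad H b v - 1 / 2 * ((‖b - H v‖ ^ 2) ^ 2 / inner ℝ p (H p)) := by
  rw [quad_add_smul hH, hrp]
  field_simp
  ring

/-- After a conjugate gradient step, the new residual is orthogonal to the old direction. -/
theorem inner_residual_cg_step {H : E →ₗ[ℝ] E} {b v p : E}
    (hrp : inner ℝ (b - H v) p = ‖b - H v‖ ^ 2) (hp : 0 < inner ℝ p (H p)) :
    inner ℝ (b - H (v + (‖b - H v‖ ^ 2 / inner ℝ p (H p)) • p)) p = 0 := by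
  rw [map_add, map_smul, ← sub_sub, inner_sub_left, inner_smul_left, hrp,
    real_inner_comm p (H p), RCLike.conj_to_real, div_mul_cancel₀ _ hp.ne', sub_self]

/-- The loop stays in the trust region and never increases the quadratic. The only properties of
conjugate gradients needed for this are that `r` is the residual at `v`, that `⟨r, p⟩ = ‖r‖²`, and
that `p` vanishes with `r`. -/
theorem tcgLoop_spec {H : E →ₗ[ℝ] E} (hH : H.IsSymmetric) (b : E) {Δ : ℝ} (κ θ : ℝ) (n : ℕ) :
    ∀ {v p : E}, ‖v‖ ≤ Δ → inner ℝ (b - H v) p = ‖b - H v‖ ^ 2 → (b - H v = 0 → p = 0) →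
      ‖tcgLoop H b Δ κ θ n v (b - H v) p‖ ≤ Δ ∧
        quad H b (tcgLoop H b Δ κ θ n v (b - H v) p) ≤ quad H b v := by
  induction n with
  | zero => intro v p hv _ _; exact ⟨hv, le_rfl⟩
  | succ n ih =>
    intro v p hv hrp hp0
    simp only [tcgLoop]
    have hres : b - H v - (‖b - H v‖ ^ 2 / inner ℝ p (H p)) • H p =
        b - H (v + (‖b - H v‖ ^ 2 / inner ℝ p (H p)) • p) := by
      rw [map_add, map_smul, sub_sub]
    rw [hres]
    split_ifs with h1 h2
    · refine ⟨norm_add_toBoundary_smul_le hv p, (quad_add_toBoundary_le hH hv hrp hp0 h1).trans ?_⟩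
      have := mul_nonneg (toBoundary_nonneg hv p) (sq_nonneg ‖b - H v‖)
      linarith
    all_goals
      push Not at h1
      have hq := quad_add_cg_step hH hrp h1.1
      have hnn : 0 ≤ (‖b - H v‖ ^ 2) ^ 2 / inner ℝ p (H p) := div_nonneg (sq_nonneg _) h1.1.le
    · exact ⟨h1.2.le, by linarith⟩
    · have horth := inner_residual_cg_step hrp h1.1
      obtain ⟨h3, h4⟩ := ih h1.2.le (p := b - H (v + (‖b - H v‖ ^ 2 / inner ℝ p (H p)) • p) +
          (‖b - H (v + (‖b - H v‖ ^ 2 / inner ℝ p (H p)) • p)‖ ^ 2 / ‖b - H v‖ ^ 2) • p)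
        (by rw [inner_add_right, inner_smul_right, horth, mul_zero, add_zero,
              real_inner_self_eq_norm_sq])
        (fun h => by rw [h]; simp)
      exact ⟨h3, by linarith⟩

theorem tcg_spec {H : E →ₗ[ℝ] E} (hH : H.IsSymmetric) (g : E) {Δ : ℝ} (hΔ : 0 ≤ Δ) (κ θ : ℝ)
    (m : ℕ) : ‖tcg H g Δ κ θ m‖ ≤ Δ ∧ quad H (-g) (tcg H g Δ κ θ m) ≤ 0 := by
  have := tcgLoop_spec hH (-g) (Δ := Δ) κ θ m (v := 0) (p := -g) (by simpa using hΔ)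
    (by rw [map_zero, sub_zero, real_inner_self_eq_norm_sq]) (fun h => by simpa using h)
  simpa [tcg, quad] using this

/-- The Cauchy decrease: already the first inner iteration achieves it. -/
theorem tcg_cauchy_decrease {H : E →ₗ[ℝ] E} (hH : H.IsSymmetric) {g : E} {Δ β : ℝ} (hΔ : 0 ≤ Δ)
    (hg : g ≠ 0) (hβ : 0 < β) (hcurv : inner ℝ g (H g) ≤ β * ‖g‖ ^ 2) (κ θ : ℝ) {m : ℕ}
    (hm : 1 ≤ m) :
    quad H (-g) (tcg H g Δ κ θ m) ≤ -(1 / 2 * (‖g‖ * min Δ (‖g‖ / β))) := by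
  obtain ⟨n, rfl⟩ : ∃ n, m = n + 1 := ⟨m - 1, by omega⟩
  have hgn : 0 < ‖g‖ := norm_pos_iff.2 hg
  have hb : -g - H 0 = -g := by rw [map_zero, sub_zero]
  have hv : ‖(0 : E)‖ ≤ Δ := by simpa using hΔ
  have hrp : inner ℝ (-g - H 0) (-g) = ‖-g - H 0‖ ^ 2 := by
    rw [hb, real_inner_self_eq_norm_sq]
  have hq0 : quad H (-g) 0 = 0 := by simp [quad]
  have hres : -g - (‖(-g : E)‖ ^ 2 / inner ℝ (-g) (H (-g))) • H (-g) =
      -g - H (0 + (‖(-g : E)‖ ^ 2 / inner ℝ (-g) (H (-g))) • (-g)) := by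
    rw [map_add, map_smul, map_zero, zero_add]
  simp only [tcg, tcgLoop]
  rw [hres]
  split_ifs with h1 h2
  · have h := quad_add_toBoundary_le hH hv hrp (fun h => by rwa [hb] at h) (by rwa [hb])
    have hτ : toBoundary Δ 0 (-g) * ‖g‖ = Δ := by
      have := norm_add_toBoundary_smul hv (neg_ne_zero.2 hg)
      rwa [zero_add, norm_smul, Real.norm_of_nonneg (toBoundary_nonneg hv _), norm_neg] at this
    rw [hq0, hb, norm_neg, sq, ← mul_assoc (toBoundary Δ 0 (-g)), hτ] at h
    have := mul_le_mul_of_nonneg_left (min_le_left Δ (‖g‖ / β)) hgn.le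
    linarith
  all_goals
    push Not at h1
    have hq := quad_add_cg_step hH hrp h1.1
    rw [hb, hq0] at hq
    have hd : ‖g‖ * (‖g‖ / β) ≤ (‖-g‖ ^ 2) ^ 2 / inner ℝ (-g) (H (-g)) := by
      have hpos := h1.1
      rw [map_neg, inner_neg_neg] at hpos ⊢
      rw [norm_neg, ← mul_div_assoc, div_le_div_iff₀ hβ hpos]
      nlinarith [mul_le_mul_of_nonneg_left hcurv (sq_nonneg ‖g‖)]
    have := mul_le_mul_of_nonneg_left (min_le_right Δ (‖g‖ / β)) hgn.le
  · linarith
  · refine (tcgLoop_spec hH (-g) κ θ n h1.2.le ?_ ?_).2.trans (by linarith)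
    · have horth := inner_residual_cg_step hrp h1.1
      rw [hb] at horth
      rw [inner_add_right, inner_smul_right, horth, mul_zero, add_zero, real_inner_self_eq_norm_sq]
    · intro h; rw [h]; simp

theorem tcgLoop_mem {H : E → E} (W : Submodule ℝ E) (hH : ∀ v, H v ∈ W) (b : E) (Δ κ θ : ℝ)
    (n : ℕ) : ∀ {v r p : E}, v ∈ W → r ∈ W → p ∈ W → tcgLoop H b Δ κ θ n v r p ∈ W := by
  induction n with
  | zero => intro v r p hv _ _; exact hv
  | succ n ih =>
    intro v r p hv hr hp
    simp only [tcgLoop]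
    have hv' : v + (‖r‖ ^ 2 / inner ℝ p (H p)) • p ∈ W := W.add_mem hv (W.smul_mem _ hp)
    have hr' : r - (‖r‖ ^ 2 / inner ℝ p (H p)) • H p ∈ W := W.sub_mem hr (W.smul_mem _ (hH p))
    split_ifs
    · exact W.add_mem hv (W.smul_mem _ hp)
    · exact hv'
    · exact ih hv' hr' (W.add_mem hr' (W.smul_mem _ hp))

theorem tcg_mem {H : E → E} (W : Submodule ℝ E) (hH : ∀ v, H v ∈ W) {g : E} (hg : g ∈ W)
    (Δ κ θ : ℝ) (m : ℕ) : tcg H g Δ κ θ m ∈ W :=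
  tcgLoop_mem W hH _ Δ κ θ m W.zero_mem (W.neg_mem hg) (W.neg_mem hg)

end TruncatedCG

/-! ### Linear structure: the projector, the Jacobians and the Gauss-Newton operator -/

section Blocks

variable {V : Type*}

theorem blk_vec (x : V → Fin 4 → ℝ) (i : V) : blk (vec x) i = x i := rfl

theorem blk_add (X Y : Amb V) (i : V) : blk (X + Y) i = blk X i + blk Y i := rfl

theorem blk_smul (c : ℝ) (X : Amb V) (i : V) : blk (c • X) i = c • blk X i := rfl

theorem blk_zero (i : V) : blk (0 : Amb V) i = 0 := rfl

theorem ext_blk {X Y : Amb V} (h : ∀ i, blk X i = blk Y i) : X = Y := by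
  ext p
  exact congrFun (h p.1) p.2

theorem blk_Exp (X S : Amb V) (i : V) : blk (Exp X S) i = expAt (blk X i) (blk S i) := rfl

theorem continuous_blk (i : V) : Continuous fun X : Amb V => blk X i :=
  continuous_pi fun l => PiLp.continuous_apply 2 _ (i, l)

variable [Fintype V]

theorem norm_blk_le (X : Amb V) (i : V) : ‖blk X i‖ ≤ ‖X‖ :=
  (pi_norm_le_iff_of_nonneg (norm_nonneg X)).2 fun l => PiLp.norm_apply_le X (i, l)

theorem inner_eq_sum_blk (X Y : Amb V) : inner ℝ X Y = ∑ i, blk X i ⬝ᵥ blk Y i := by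
  rw [PiLp.inner_apply, Fintype.sum_prod_type]
  refine Finset.sum_congr rfl fun i _ => Finset.sum_congr rfl fun l _ => ?_
  simp [blk, mul_comm]

end Blocks

theorem dLogOne_add (r u v : Fin 4 → ℝ) : dLogOne r (u + v) = dLogOne r u + dLogOne r v := by
  simp only [dLogOne, tail_add, Pi.add_apply, smul_add]
  ext i
  simp only [Pi.add_apply, Pi.smul_apply, smul_eq_mul]
  ring

theorem dLogOne_smul (r : Fin 4 → ℝ) (c : ℝ) (u : Fin 4 → ℝ) :
    dLogOne r (c • u) = c • dLogOne r u := by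
  simp only [dLogOne, tail_smul, Pi.smul_apply, smul_add, smul_eq_mul]
  ext i
  simp only [Pi.add_apply, Pi.smul_apply, smul_eq_mul]
  ring

theorem mulVec_of_linear (f : (Fin 4 → ℝ) →ₗ[ℝ] Fin 3 → ℝ) (s : Fin 4 → ℝ) :
    (Matrix.of fun m l => f (Pi.single l 1) m) *ᵥ s = f s := by
  conv_rhs => rw [← LinearMap.toMatrix'_mulVec f s]
  rfl

theorem exists_norm_dLogOne_le (R : ℝ) (hR : 0 ≤ R) : ∃ C : ℝ, 0 ≤ C ∧ ∀ r dr : Fin 4 → ℝ,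
    r ∈ M → ‖r‖ ≤ R → ‖dLogOne r dr‖ ≤ C * ‖dr‖ := by
  obtain ⟨F, hF0, hF⟩ := exists_abs_f1_le
  refine ⟨2 + F * (2 * R) * R, by positivity, fun r dr hrM hr => ?_⟩
  have hn : r 0 ^ 2 + r 1 ^ 2 = 1 := hrM
  have h1 : |r 0 * dr 1 - r 1 * dr 0| ≤ 2 * (R * ‖dr‖) := (abs_rot_le r dr).trans (by gcongr)
  have hg : |1 / gam r| ≤ 2 := by
    rw [abs_of_pos (one_div_pos.2 (gam_pos r))]; exact one_div_gam_le r
  rw [dLogOne, hn, div_one]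
  calc _ ≤ 2 * ‖dr‖ + F * (2 * (R * ‖dr‖)) * R := by
        refine (norm_add_le _ _).trans (add_le_add ?_ ?_)
        · rw [norm_smul]
          exact mul_le_mul hg (norm_tail_le dr) (norm_nonneg _) two_pos.le
        · rw [norm_smul, norm_mul]
          exact mul_le_mul (mul_le_mul (hF _ (abs_phi_le r)) h1 (norm_nonneg _) hF0)
            ((norm_tail_le r).trans hr) (norm_nonneg _) (by positivity)
    _ = _ := by ring

theorem Exp_zero {V : Type*} (X : Amb V) : Exp X 0 = X :=
  ext_blk fun i => by rw [blk_Exp, blk_zero, expAt_zero_right]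

namespace PoseGraph

variable {V : Type*} (G : PoseGraph V)

theorem res_eq (e : V × V) (X : Amb V) : G.res e X = resid (G.meas e) (blk X e.1) (blk X e.2) := rfl

theorem res_mem {e : V × V} (he : e ∈ G.edges) {X : Amb V} (hX : ∀ i, blk X i ∈ M) :
    G.res e X ∈ M := resid_mem (G.meas_mem e he) (hX _) (hX _)

theorem jacA_mulVec (e : V × V) (X : Amb V) (s : Fin 4 → ℝ) :
    G.jacA e X *ᵥ s = dLogOne (G.res e X) (resid (G.meas e) s (blk X e.2)) :=
  mulVec_of_linear
    { toFun := fun s => dLogOne (G.res e X) (resid (G.meas e) s (blk X e.2))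
      map_add' := fun u v => by rw [resid_add_left, dLogOne_add]
      map_smul' := fun c u => by rw [resid_smul_left, dLogOne_smul, RingHom.id_apply] } s

theorem jacB_mulVec (e : V × V) (X : Amb V) (s : Fin 4 → ℝ) :
    G.jacB e X *ᵥ s = dLogOne (G.res e X) (resid (G.meas e) (blk X e.1) s) :=
  mulVec_of_linear
    { toFun := fun s => dLogOne (G.res e X) (resid (G.meas e) (blk X e.1) s)
      map_add' := fun u v => by rw [resid_add_right, dLogOne_add]
      map_smul' := fun c u => by rw [resid_smul_right, dLogOne_smul, RingHom.id_apply] } s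

/-- The derivative of the tangent residual of the edge `e` at `X` in the direction `S`. -/
def jac (e : V × V) (X S : Amb V) : Fin 3 → ℝ :=
  G.jacA e X *ᵥ blk S e.1 + G.jacB e X *ᵥ blk S e.2

theorem jac_eq (e : V × V) (X S : Amb V) : G.jac e X S =
    dLogOne (G.res e X) (dresid (G.meas e) (blk X e.1) (blk X e.2) (blk S e.1) (blk S e.2)) := by
  rw [jac, jacA_mulVec, jacB_mulVec, dresid, dLogOne_add]

theorem info_posDef {e : V × V} (he : e ∈ G.edges) : (G.info e).PosDef := (G.cov_posDef e he).inv

theorem info_isSymm {e : V × V} (he : e ∈ G.edges) : (G.info e).IsSymm := by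
  have := (G.info_posDef he).isHermitian
  rwa [Matrix.IsHermitian, Matrix.conjTranspose_eq_transpose_of_trivial] at this

theorem Exp_mem_space {X S : Amb V} (hX : X ∈ G.space) (hS : S ∈ G.tangent X) :
    Exp X S ∈ G.space := by
  refine ⟨fun i => ?_, fun a ha => ?_⟩
  · rw [blk_Exp]
    exact expAt_mem (hX.1 i) (blk S i)
  · rw [blk_Exp, hS.2 a ha, expAt_zero_right, hX.2 a ha]

theorem obj_eq_sum (X : Amb V) :
    G.obj X = ∑ e ∈ G.edges, cost (G.info e) (G.res e X) := by
  rw [obj, Finset.mul_sum]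
  rfl

theorem jac_add (e : V × V) (X S T : Amb V) : G.jac e X (S + T) = G.jac e X S + G.jac e X T := by
  simp only [jac, blk_add, Matrix.mulVec_add]
  abel

theorem jac_smul (e : V × V) (c : ℝ) (X S : Amb V) : G.jac e X (c • S) = c • G.jac e X S := by
  simp only [jac, blk_smul, Matrix.mulVec_smul, smul_add]

theorem exists_norm_jac_le [Fintype V] (R : ℝ) (hR : 0 ≤ R) : ∃ C : ℝ, 0 ≤ C ∧
    ∀ e ∈ G.edges, ∀ X S : Amb V,
    (∀ i, blk X i ∈ M) → (∀ i, ‖blk X i‖ ≤ R) → ‖G.meas e‖ ≤ R → ‖G.jac e X S‖ ≤ C * ‖S‖ := by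
  obtain ⟨C, hC0, hC⟩ := exists_norm_dLogOne_le (16 * (R * R * R)) (by positivity)
  refine ⟨C * (32 * (R * R)), by positivity, fun e he X S hXM hX hz => ?_⟩
  rw [jac_eq]
  calc _ ≤ C * ‖dresid (G.meas e) (blk X e.1) (blk X e.2) (blk S e.1) (blk S e.2)‖ :=
        hC _ _ (G.res_mem he hXM) (norm_resid_le_of_le hz (hX _) (hX _))
    _ ≤ C * (16 * (R * ‖S‖ * R) + 16 * (R * R * ‖S‖)) := by
        gcongr
        exact (norm_add_le _ _).trans (add_le_add
          (norm_resid_le_of_le hz (norm_blk_le S _) (hX _))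
          (norm_resid_le_of_le hz (hX _) (norm_blk_le S _)))
    _ = _ := by ring

variable [DecidableEq V]

theorem blk_proj_of_mem {i : V} (hi : i ∈ G.anchors) (X U : Amb V) : blk (G.proj X U) i = 0 := by
  simp [proj, blk_vec, hi]

theorem proj_add (X U W : Amb V) : G.proj X (U + W) = G.proj X U + G.proj X W := by
  refine ext_blk fun i => ?_
  by_cases hi : i ∈ G.anchors
  · simp [blk_add, blk_proj_of_mem, hi]
  · simp only [blk_add, proj, blk_vec, hi, if_false]
    ext l; fin_cases l <;> simp <;> ring

theorem proj_smul (c : ℝ) (X U : Amb V) : G.proj X (c • U) = c • G.proj X U := by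
  refine ext_blk fun i => ?_
  by_cases hi : i ∈ G.anchors
  · simp [blk_smul, blk_proj_of_mem, hi]
  · simp only [blk_smul, proj, blk_vec, hi, if_false]
    ext l; fin_cases l <;> simp <;> ring

theorem proj_mem_tangent {X : Amb V} (hX : ∀ i, blk X i ∈ M) (U : Amb V) :
    G.proj X U ∈ G.tangent X := by
  refine ⟨fun i => ?_, fun a ha => blk_proj_of_mem G ha X U⟩
  by_cases hi : i ∈ G.anchors
  · simp [blk_proj_of_mem, hi]
  · have h : blk X i 0 ^ 2 + blk X i 1 ^ 2 = 1 := hX i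
    simp only [proj, blk_vec, hi, if_false, Matrix.cons_val_zero, Matrix.cons_val_one]
    linear_combination -(blk X i 0 * blk U i 0 + blk X i 1 * blk U i 1) * h

theorem proj_eq_self {X S : Amb V} (hS : S ∈ G.tangent X) : G.proj X S = S := by
  refine ext_blk fun i => ?_
  by_cases hi : i ∈ G.anchors
  · rw [blk_proj_of_mem G hi, hS.2 i hi]
  · simp only [proj, blk_vec, hi, if_false, hS.1 i]
    ext l; fin_cases l <;> simp

/-- The tangent space at `X` as a submodule. -/
def tangentSubmodule (X : Amb V) : Submodule ℝ (Amb V) where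
  carrier := G.tangent X
  add_mem' := fun {S T} hS hT =>
    ⟨fun i => by
      simp only [blk_add, Pi.add_apply]
      linear_combination hS.1 i + hT.1 i,
     fun a ha => by rw [blk_add, hS.2 a ha, hT.2 a ha, add_zero]⟩
  zero_mem' := ⟨fun i => by simp [blk_zero], fun a _ => blk_zero a⟩
  smul_mem' := fun c S hS =>
    ⟨fun i => by
      simp only [blk_smul, Pi.smul_apply, smul_eq_mul]
      linear_combination c * hS.1 i,
     fun a ha => by rw [blk_smul, hS.2 a ha, smul_zero]⟩

theorem grad_mem_tangent {X : Amb V} (hX : ∀ i, blk X i ∈ M) : G.grad X ∈ G.tangent X :=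
  proj_mem_tangent G hX _

theorem hess_mem_tangent {X : Amb V} (hX : ∀ i, blk X i ∈ M) (U : Amb V) :
    G.hess X U ∈ G.tangentSubmodule X :=
  Submodule.sum_mem _ fun _ _ => proj_mem_tangent G hX _

variable [Fintype V]

/-- `jacT` is the adjoint of `jac`. -/
theorem inner_jacT (e : V × V) (X S : Amb V) (w : Fin 3 → ℝ) :
    inner ℝ S (G.jacT e X w) = G.jac e X S ⬝ᵥ w := by
  have h : ∀ (A : Matrix (Fin 3) (Fin 4) ℝ) (s : Fin 4 → ℝ), s ⬝ᵥ (Aᵀ *ᵥ w) = (A *ᵥ s) ⬝ᵥ w :=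
    fun A s => by
      rw [Matrix.mulVec_transpose, dotProduct_comm, ← Matrix.dotProduct_mulVec, dotProduct_comm]
  have h' : ∀ (k : V) (u : Fin 4 → ℝ),
      ∑ i, blk S i ⬝ᵥ (if i = k then u else 0) = blk S k ⬝ᵥ u := fun k u => by
    rw [Finset.sum_eq_single k (fun i _ hi => by rw [if_neg hi, dotProduct_zero])
      (fun hk => absurd (Finset.mem_univ k) hk), if_pos rfl]
  simp only [inner_eq_sum_blk, jacT, blk_vec, dotProduct_add, Finset.sum_add_distrib, h', h, jac,
    add_dotProduct]

theorem inner_proj_comm (X U W : Amb V) : inner ℝ (G.proj X U) W = inner ℝ U (G.proj X W) := by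
  rw [inner_eq_sum_blk, inner_eq_sum_blk]
  refine Finset.sum_congr rfl fun i _ => ?_
  by_cases hi : i ∈ G.anchors
  · rw [blk_proj_of_mem G hi, blk_proj_of_mem G hi, zero_dotProduct, dotProduct_zero]
  · simp only [proj, blk_vec, hi, if_false, dotProduct, Fin.sum_univ_four, Matrix.cons_val_zero,
      Matrix.cons_val_one, Matrix.cons_val]
    ring

theorem norm_proj_le {X : Amb V} (hX : ∀ i, blk X i ∈ M) (U : Amb V) : ‖G.proj X U‖ ≤ ‖U‖ := by
  have h : ‖G.proj X U‖ * ‖G.proj X U‖ ≤ ‖U‖ * ‖G.proj X U‖ := by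
    rw [← real_inner_self_eq_norm_mul_norm, inner_proj_comm,
      proj_eq_self G (proj_mem_tangent G hX U)]
    exact real_inner_le_norm _ _
  rcases (norm_nonneg (G.proj X U)).eq_or_lt with h0 | h0
  · rw [← h0]; exact norm_nonneg U
  · exact le_of_mul_le_mul_right h h0

theorem inner_grad {X S : Amb V} (hS : S ∈ G.tangent X) : inner ℝ S (G.grad X) =
    ∑ e ∈ G.edges, G.jac e X S ⬝ᵥ (G.info e *ᵥ G.err e X) := by
  rw [grad, ← inner_proj_comm, proj_eq_self G hS, egrad, inner_sum]
  simp only [inner_jacT]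

theorem inner_hess (X U W : Amb V) : inner ℝ U (G.hess X W) = ∑ e ∈ G.edges,
    G.jac e X (G.proj X U) ⬝ᵥ (G.info e *ᵥ G.jac e X (G.proj X W)) := by
  rw [hess, inner_sum]
  refine Finset.sum_congr rfl fun e _ => ?_
  rw [← inner_proj_comm, inner_jacT]
  rfl

/-- The Gauss-Newton operator as a linear map. -/
def hessLin (X : Amb V) : Amb V →ₗ[ℝ] Amb V where
  toFun := G.hess X
  map_add' := fun U W => ext_inner_left ℝ fun S => by
    simp only [inner_add_right, inner_hess, proj_add, jac_add, Matrix.mulVec_add, dotProduct_add,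
      Finset.sum_add_distrib]
  map_smul' := fun c U => ext_inner_left ℝ fun S => by
    simp only [RingHom.id_apply, inner_smul_right, inner_hess, proj_smul, jac_smul,
      Matrix.mulVec_smul, dotProduct_smul, smul_eq_mul, Finset.mul_sum]

theorem hessLin_apply (X U : Amb V) : G.hessLin X U = G.hess X U := rfl

theorem hessLin_isSymmetric (X : Amb V) : (G.hessLin X).IsSymmetric := fun U W => by
  rw [hessLin_apply, hessLin_apply, real_inner_comm, inner_hess, inner_hess]
  refine Finset.sum_congr rfl fun e he => ?_
  exact dotProduct_mulVec_comm (G.info_isSymm he) _ _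

theorem inner_hess_self_nonneg (X U : Amb V) : 0 ≤ inner ℝ U (G.hess X U) := by
  rw [inner_hess]
  refine Finset.sum_nonneg fun e he => ?_
  simpa using (G.info_posDef he).posSemidef.dotProduct_mulVec_nonneg (G.jac e X (G.proj X U))

theorem hess_smul (c : ℝ) (X U : Amb V) : G.hess X (c • U) = c • G.hess X U :=
  (G.hessLin X).map_smul c U

theorem inner_hess_le {X S : Amb V} {β : ℝ} (hβ : G.HessBound β X) (hS : S ∈ G.tangent X) :
    inner ℝ S (G.hess X S) ≤ β * ‖S‖ ^ 2 := by
  by_cases h0 : S = 0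
  · simp [h0]
  · have hn := norm_ne_zero_iff.2 h0
    have h1 := hβ (‖S‖⁻¹ • S) ((G.tangentSubmodule X).smul_mem _ hS)
      (by rw [norm_smul, norm_inv, norm_norm, inv_mul_cancel₀ hn])
    rw [hess_smul, norm_smul, norm_inv, norm_norm, inv_mul_le_iff₀ (norm_pos_iff.2 h0)] at h1
    calc _ ≤ ‖S‖ * ‖G.hess X S‖ := real_inner_le_norm _ _
      _ ≤ ‖S‖ * (‖S‖ * β) := by gcongr
      _ = _ := by ring

/-- The trust-region model as a constant plus the quadratic minimized by conjugate gradients. -/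
theorem model_eq (X S : Amb V) : G.model X S = G.obj X + quad (G.hessLin X) (-G.grad X) S := by
  rw [model, quad, hessLin_apply, inner_neg_left, real_inner_comm]
  ring

theorem exists_hessBound (R : ℝ) (hR : 0 ≤ R) (hz : ∀ e ∈ G.edges, ‖G.meas e‖ ≤ R) :
    ∃ β : ℝ, 0 < β ∧ ∀ X : Amb V, (∀ i, blk X i ∈ M) → (∀ i, ‖blk X i‖ ≤ R) → G.HessBound β X := by
  obtain ⟨C, hC0, hC⟩ := G.exists_norm_jac_le R hR
  set B : V × V → ℝ := fun e => ∑ i, ∑ j, |G.info e i j| with hB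
  have hB0 : ∀ e, 0 ≤ B e := fun e => by positivity
  have hs : 0 ≤ ∑ e ∈ G.edges, B e * (C * C) :=
    Finset.sum_nonneg fun e _ => mul_nonneg (hB0 e) (by positivity)
  refine ⟨∑ e ∈ G.edges, B e * (C * C) + 1, by positivity, fun X hXM hX S _ hS1 => ?_⟩
  -- testing with `H(X)S` itself reduces the claim to the bilinear form
  have h : ‖G.hess X S‖ * ‖G.hess X S‖ ≤ (∑ e ∈ G.edges, B e * (C * C)) * ‖G.hess X S‖ := by
    rw [← real_inner_self_eq_norm_mul_norm]
    conv_lhs => rw [inner_hess]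
    rw [Finset.sum_mul]
    refine Finset.sum_le_sum fun e he => ?_
    have hj : ∀ U : Amb V, ‖G.jac e X (G.proj X U)‖ ≤ C * ‖U‖ := fun U =>
      (hC e he X _ hXM hX (hz e he)).trans (by gcongr; exact G.norm_proj_le hXM U)
    have h1 := hj (G.hess X S)
    have h2 := hj S
    rw [hS1, mul_one] at h2
    calc _ ≤ B e * (‖G.jac e X (G.proj X (G.hess X S))‖ * ‖G.jac e X (G.proj X S)‖) :=
          (le_abs_self _).trans (abs_dotProduct_mulVec_le _ _ _)
      _ ≤ B e * (C * ‖G.hess X S‖ * C) :=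
          mul_le_mul_of_nonneg_left (mul_le_mul h1 h2 (norm_nonneg _) (by positivity)) (hB0 e)
      _ = _ := by ring
  rcases (norm_nonneg (G.hess X S)).eq_or_lt with h0 | h0
  · rw [← h0]; positivity
  · linarith [le_of_mul_le_mul_right h h0]

end PoseGraph

/-! ### The Lipschitz-type conditions on bounded sets -/

namespace PoseGraph

variable {V : Type*} (G : PoseGraph V)

theorem exists_edge_expansion [Fintype V] {e : V × V} (he : e ∈ G.edges) (R D : ℝ)
    (hR : 0 ≤ R) (hD : 0 ≤ D) (hz : ‖G.meas e‖ ≤ R) : ∃ C : ℝ, 0 ≤ C ∧ ∀ X ∈ G.space, (∀ i, ‖blk X i‖ ≤ R) →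
      ∀ S ∈ G.tangent X, ‖S‖ ≤ D →
      cost (G.info e) (G.res e (Exp X S)) ≤ cost (G.info e) (G.res e X) +
        G.jac e X S ⬝ᵥ (G.info e *ᵥ G.err e X) + C * ‖S‖ ^ 2 ∧
      (G.NoHalfTurn X S → |cost (G.info e) (G.res e (Exp X S)) - (cost (G.info e) (G.res e X) +
        G.jac e X S ⬝ᵥ (G.info e *ᵥ G.err e X))| ≤ C * ‖S‖ ^ 2) := by
  obtain ⟨C, hC0, hC⟩ := exists_cost_expansion (G.info_posDef he) R D hR hD
  refine ⟨C, hC0, fun X hX hXR S hS hSD => ?_⟩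
  obtain ⟨h1, h2⟩ := hC (G.meas e) (blk X e.1) (blk X e.2) (blk S e.1) (blk S e.2) ‖S‖
    (G.meas_mem e he) (hX.1 _) (hX.1 _) hz (hXR _) (hXR _) (hS.1 _) (hS.1 _)
    (norm_blk_le S _) (norm_blk_le S _) hSD
  rw [jac_eq, err, res_eq, res_eq, blk_Exp, blk_Exp]
  refine ⟨h1, fun hne => h2 fun τ hτ => ?_⟩
  have := hne e he τ hτ
  rwa [res_eq, blk_Exp, blk_Exp, blk_smul, blk_smul] at this

theorem exists_lipType [Fintype V] [DecidableEq V] (R D : ℝ) (hR : 0 ≤ R) (hD : 0 ≤ D)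
    (hz : ∀ e ∈ G.edges, ‖G.meas e‖ ≤ R) : ∃ L : ℝ, 0 ≤ L ∧ ∀ X ∈ G.space,
      (∀ i, ‖blk X i‖ ≤ R) → G.LipType D L X ∧ G.LipTypeAbs D L X := by
  choose! C hC using fun e he => G.exists_edge_expansion (e := e) he R D hR hD (hz e he)
  have hsum : ∀ t : ℝ, 2 * (∑ e ∈ G.edges, C e) / 2 * t = ∑ e ∈ G.edges, C e * t := fun t => by
    rw [mul_div_cancel_left₀ _ two_ne_zero, Finset.sum_mul]
  refine ⟨2 * ∑ e ∈ G.edges, C e,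
    mul_nonneg two_pos.le (Finset.sum_nonneg fun e he => (hC e he).1), fun X hX hXR => ⟨?_, ?_⟩⟩
  · intro S hS hSD
    rw [obj_eq_sum, obj_eq_sum, inner_grad G hS, hsum, ← Finset.sum_add_distrib,
      ← Finset.sum_add_distrib]
    exact Finset.sum_le_sum fun e he => ((hC e he).2 X hX hXR S hS hSD).1
  · intro S hS hSD hne
    rw [obj_eq_sum, obj_eq_sum, inner_grad G hS, hsum, ← Finset.sum_add_distrib,
      ← Finset.sum_sub_distrib]
    exact (Finset.abs_sum_le_sum_abs _ _).trans
      (Finset.sum_le_sum fun e he => ((hC e he).2 X hX hXR S hS hSD).2 hne)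

end PoseGraph

/-! ### Boundedness of sublevel sets and existence of a minimizer -/

theorem exists_le_dotProduct_mulVec {Ω : Matrix (Fin 3) (Fin 3) ℝ} (hΩ : Ω.PosDef) :
    ∃ c : ℝ, 0 < c ∧ ∀ u : Fin 3 → ℝ, c * ‖u‖ ^ 2 ≤ u ⬝ᵥ (Ω *ᵥ u) := by
  have hcont : Continuous fun u : Fin 3 → ℝ => u ⬝ᵥ (Ω *ᵥ u) :=
    continuous_id.dotProduct (continuous_const.matrix_mulVec continuous_id)
  have hpos : ∀ u : Fin 3 → ℝ, u ≠ 0 → 0 < u ⬝ᵥ (Ω *ᵥ u) := fun u hu => by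
    simpa using hΩ.dotProduct_mulVec_pos hu
  obtain ⟨w, hw, hmin⟩ := (isCompact_sphere (0 : Fin 3 → ℝ) 1).exists_isMinOn
    (NormedSpace.sphere_nonempty.2 zero_le_one) hcont.continuousOn
  have hw1 : ‖w‖ = 1 := by simpa using hw
  refine ⟨w ⬝ᵥ (Ω *ᵥ w), hpos w (norm_ne_zero_iff.1 (by rw [hw1]; exact one_ne_zero)),
    fun u => ?_⟩
  by_cases hu : u = 0
  · simp [hu]
  · have hn := norm_pos_iff.2 hu
    have h := isMinOn_iff.1 hmin (‖u‖⁻¹ • u) (by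
      rw [mem_sphere_zero_iff_norm, norm_smul, norm_inv, norm_norm, inv_mul_cancel₀ hn.ne'])
    rw [Matrix.mulVec_smul, smul_dotProduct, dotProduct_smul, smul_eq_mul, smul_eq_mul,
      ← mul_assoc, ← mul_inv, ← sq, inv_mul_eq_div, le_div_iff₀ (pow_pos hn 2)] at h
    exact h

theorem cost_nonneg {Ω : Matrix (Fin 3) (Fin 3) ℝ} (hΩ : Ω.PosDef) (r : Fin 4 → ℝ) :
    0 ≤ cost Ω r := by
  have : 0 ≤ logOne r ⬝ᵥ (Ω *ᵥ logOne r) := by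
    simpa using hΩ.posSemidef.dotProduct_mulVec_nonneg (logOne r)
  rw [cost]
  positivity

theorem exists_norm_le_of_cost_le {Ω : Matrix (Fin 3) (Fin 3) ℝ} (hΩ : Ω.PosDef) (c : ℝ) :
    ∃ K : ℝ, 0 ≤ K ∧ ∀ r ∈ M, cost Ω r ≤ c → ‖r‖ ≤ K := by
  obtain ⟨m, hm, hle⟩ := exists_le_dotProduct_mulVec hΩ
  refine ⟨2 * |c| / m + 1, by positivity, fun r hr hc => ?_⟩
  have hn : r 0 ^ 2 + r 1 ^ 2 = 1 := hr
  have hb := hle (tail r)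
  have hg : 1 ≤ (1 / gam r) ^ 2 := one_le_pow₀ (one_le_one_div_gam r)
  have hb0 : 0 ≤ m * ‖tail r‖ ^ 2 := by positivity
  have h1 : m * ‖tail r‖ ^ 2 ≤ 2 * |c| := by
    rw [cost_eq] at hc
    nlinarith [le_abs_self c]
  rw [mul_comm, ← le_div_iff₀ hm] at h1
  have hc0 : 0 ≤ 2 * |c| / m := by positivity
  have h2 : ‖tail r‖ ≤ 2 * |c| / m + 1 := by nlinarith [norm_nonneg (tail r)]
  refine (pi_norm_le_iff_of_nonneg (by positivity)).2 fun i => ?_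
  have ht := fun k => (abs_apply_le (tail r) k).trans h2
  have h0 : |r 0| ≤ 1 := abs_le_one_iff_mul_self_le_one.2 (by nlinarith [sq_nonneg (r 1)])
  rw [Real.norm_eq_abs]
  fin_cases i
  · exact h0.trans (by linarith)
  · exact ht 0
  · exact ht 1
  · exact ht 2

/-- The second pose of an edge, recovered from the first pose, the measurement and the residual. -/
theorem eq_mul_resid {z x : Fin 4 → ℝ} (hz : z ∈ M) (hx : x ∈ M) (y : Fin 4 → ℝ) :
    y = mul (mul x z) (resid z x y) := by
  rw [resid, pudq_mul_assoc (inv z), pudq_mul_assoc x z, ← pudq_mul_assoc z, pudq_mul_inv_self hz,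
    pudq_one_mul, ← pudq_mul_assoc, pudq_mul_inv_self hx, pudq_one_mul]

/-- The first pose of an edge, recovered from the second pose, the measurement and the residual. -/
theorem eq_mul_inv_resid {z y : Fin 4 → ℝ} (hz : z ∈ M) (hy : y ∈ M) (x : Fin 4 → ℝ) :
    x = mul (mul y (inv (resid z x y))) (inv z) := by
  rw [resid, inv_pudq_mul, inv_pudq_mul, pudq_inv_inv, pudq_inv_inv, ← pudq_mul_assoc y,
    pudq_mul_inv_self hy, pudq_one_mul, pudq_mul_assoc, pudq_mul_inv_self hz, pudq_mul_one]

/-- The residual is invariant under left translations of both poses. -/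
theorem resid_mul_left {g : Fin 4 → ℝ} (hg : g ∈ M) (z x y : Fin 4 → ℝ) :
    resid z (mul g x) (mul g y) = resid z x y := by
  rw [resid, resid, inv_pudq_mul, ← pudq_mul_assoc, ← pudq_mul_assoc, pudq_mul_assoc _ (inv g),
    pudq_inv_mul_self hg, pudq_mul_one]

theorem isClosed_M : IsClosed M :=
  isClosed_eq (by fun_prop) continuous_const

namespace PoseGraph

variable {V : Type*} (G : PoseGraph V)

theorem cost_le_obj {e : V × V} (he : e ∈ G.edges) (X : Amb V) :
    cost (G.info e) (G.res e X) ≤ G.obj X := by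
  rw [obj_eq_sum]
  exact Finset.single_le_sum (f := fun e => cost (G.info e) (G.res e X))
    (fun e he => cost_nonneg (G.info_posDef he) _) he

theorem exists_norm_blk_le_of_adj {i j : V}
    (h : (SimpleGraph.fromRel fun i j : V => (i, j) ∈ G.edges).Adj i j) (c : ℝ) :
    ∃ K : ℝ, 0 ≤ K ∧ ∀ X : Amb V, (∀ i, blk X i ∈ M) → G.obj X ≤ c →
      ‖blk X j‖ ≤ K * ‖blk X i‖ := by
  have hnorm : ∀ x y z : Fin 4 → ℝ, ‖mul (mul x y) z‖ ≤ 16 * (‖x‖ * ‖y‖ * ‖z‖) := fun x y z =>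
    calc _ ≤ 4 * (‖mul x y‖ * ‖z‖) := norm_pudq_mul_le _ _
      _ ≤ 4 * ((4 * (‖x‖ * ‖y‖)) * ‖z‖) := by gcongr; exact norm_pudq_mul_le _ _
      _ = _ := by ring
  rw [SimpleGraph.fromRel_adj] at h
  rcases h.2 with he | he
  · obtain ⟨K, hK0, hK⟩ := exists_norm_le_of_cost_le (G.info_posDef he) c
    refine ⟨16 * (‖G.meas (i, j)‖ * K), by positivity, fun X hX hc => ?_⟩
    have hr := hK _ (G.res_mem he hX) ((G.cost_le_obj he X).trans hc)
    rw [eq_mul_resid (G.meas_mem _ he) (hX i) (blk X j)]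
    calc _ ≤ 16 * (‖blk X i‖ * ‖G.meas (i, j)‖ * K) := (hnorm _ _ _).trans (by gcongr; exact hr)
      _ = _ := by ring
  · obtain ⟨K, hK0, hK⟩ := exists_norm_le_of_cost_le (G.info_posDef he) c
    refine ⟨16 * (K * ‖G.meas (j, i)‖), by positivity, fun X hX hc => ?_⟩
    have hr := hK _ (G.res_mem he hX) ((G.cost_le_obj he X).trans hc)
    rw [eq_mul_inv_resid (G.meas_mem _ he) (hX i) (blk X j)]
    calc _ ≤ 16 * (‖blk X i‖ * K * ‖G.meas (j, i)‖) := (hnorm _ _ _).trans (by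
          gcongr
          · exact (norm_inv_le _).trans hr
          · exact norm_inv_le _)
      _ = _ := by ring

/-- On a connected pose graph, sublevel sets of the objective are bounded once one pose is fixed:
along every edge the objective controls the residual. -/
theorem exists_norm_blk_le [Fintype V]
    (hconn : (SimpleGraph.fromRel fun i j : V => (i, j) ∈ G.edges).Connected) (a : V) (c : ℝ) :
    ∃ R : ℝ, 0 ≤ R ∧ ∀ X : Amb V, (∀ i, blk X i ∈ M) → G.obj X ≤ c → blk X a = one →
      ∀ i, ‖blk X i‖ ≤ R := by
  have hvert : ∀ i : V, ∃ R : ℝ, 0 ≤ R ∧ ∀ X : Amb V, (∀ i, blk X i ∈ M) → G.obj X ≤ c →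
      blk X a = one → ‖blk X i‖ ≤ R := fun i => by
    have hreach := (SimpleGraph.reachable_iff_reflTransGen a i).1 (hconn.preconnected a i)
    induction hreach with
    | refl => exact ⟨‖one‖, norm_nonneg _, fun X _ _ ha => by rw [ha]⟩
    | tail _ hadj ih =>
      obtain ⟨R, hR0, hR⟩ := ih
      obtain ⟨K, hK0, hK⟩ := G.exists_norm_blk_le_of_adj hadj c
      exact ⟨K * R, by positivity, fun X hX hc ha =>
        (hK X hX hc).trans (by gcongr; exact hR X hX hc ha)⟩
  choose R hR0 hR using hvert
  exact ⟨∑ i, R i, Finset.sum_nonneg fun i _ => hR0 i, fun X hX hc ha i =>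
    (hR i X hX hc ha).trans (Finset.single_le_sum (fun i _ => hR0 i) (Finset.mem_univ i))⟩

theorem continuousOn_obj : ContinuousOn G.obj {X | ∀ i, blk X i ∈ M} := by
  have hcost : ∀ Ω : Matrix (Fin 3) (Fin 3) ℝ, ContinuousOn (cost Ω) M := fun Ω => by
    have hq : Continuous fun u : Fin 3 → ℝ => 1 / 2 * (u ⬝ᵥ (Ω *ᵥ u)) :=
      continuous_const.mul (continuous_id.dotProduct (continuous_const.matrix_mulVec continuous_id))
    exact hq.comp_continuousOn continuousOn_logOne
  have hmul : Continuous fun p : (Fin 4 → ℝ) × (Fin 4 → ℝ) => mul p.1 p.2 := by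
    unfold mul
    refine continuous_pi fun i => ?_
    fin_cases i <;> simp <;> fun_prop
  have hinv : Continuous inv := by
    unfold inv
    refine continuous_pi fun i => ?_
    fin_cases i <;> simp <;> fun_prop
  have hres : ∀ e, Continuous (G.res e) := fun e => by
    have hz : Continuous fun _ : Amb V => inv (G.meas e) := continuous_const
    exact hmul.comp ((hmul.comp (hz.prodMk (hinv.comp (continuous_blk e.1)))).prodMk
      (continuous_blk e.2))
  have : ContinuousOn (fun X => ∑ e ∈ G.edges, cost (G.info e) (G.res e X))
      {X | ∀ i, blk X i ∈ M} :=
    continuousOn_finsetSum _ fun e he => (hcost _).comp (hres e).continuousOn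
      fun X hX => G.res_mem he hX
  exact this.congr fun X _ => G.obj_eq_sum X

theorem isClosed_space : IsClosed G.space := by
  have h : G.space = (⋂ i, (fun X => blk X i) ⁻¹' M) ∩
      ⋂ a ∈ G.anchors, (fun X => blk X a) ⁻¹' {one} := by
    ext X
    simp [space]
  rw [h]
  exact (isClosed_iInter fun i => isClosed_M.preimage (continuous_blk i)).inter
    (isClosed_biInter fun a _ => isClosed_singleton.preimage (continuous_blk a))

/-- Every point of the search space can be moved, without changing the objective, to one with the
pose `1` at a suitable vertex `a`. -/
theorem exists_normalized [Nonempty V] : ∃ a : V, ∀ X ∈ G.space,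
    ∃ Y ∈ G.space, G.obj Y = G.obj X ∧ blk Y a = one := by
  rcases G.anchors.eq_empty_or_nonempty with h0 | ⟨a, ha⟩
  · obtain ⟨a⟩ := ‹Nonempty V›
    refine ⟨a, fun X hX => ⟨vec fun i => mul (inv (blk X a)) (blk X i),
      ⟨fun i => mul_mem (inv_mem (hX.1 a)) (hX.1 i), by simp [h0]⟩, ?_,
      pudq_inv_mul_self (hX.1 a)⟩⟩
    rw [obj_eq_sum, obj_eq_sum]
    refine Finset.sum_congr rfl fun e _ => ?_
    rw [res_eq, res_eq, blk_vec, blk_vec, resid_mul_left (inv_mem (hX.1 a))]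
  · exact ⟨a, fun X hX => ⟨X, hX, rfl, hX.2 a ha⟩⟩

theorem exists_minimizer [Fintype V]
    (hconn : (SimpleGraph.fromRel fun i j : V => (i, j) ∈ G.edges).Connected)
    {X₀ : Amb V} (hX₀ : X₀ ∈ G.space) :
    ∃ Xstar ∈ G.space, ∀ X ∈ G.space, G.obj Xstar ≤ G.obj X := by
  have := hconn.nonempty
  obtain ⟨a, ha⟩ := G.exists_normalized
  obtain ⟨Y₀, hY₀, hobj₀, hY₀a⟩ := ha X₀ hX₀
  obtain ⟨R, hR0, hR⟩ := G.exists_norm_blk_le hconn a (G.obj X₀)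
  set S := G.space ∩ {X : Amb V | ∀ i, ‖blk X i‖ ≤ R} with hS
  have hclosed : IsClosed S := by
    refine G.isClosed_space.inter ?_
    rw [Set.ofPred_forall]
    exact isClosed_iInter fun i => isClosed_le (continuous_blk i).norm continuous_const
  have hbdd : Bornology.IsBounded S := by
    refine (isBounded_iff_forall_norm_le).2 ⟨∑ _p : V × Fin 4, R, fun X hX => ?_⟩
    have h : ‖X‖ ^ 2 ≤ (∑ _p : V × Fin 4, R) ^ 2 := by
      rw [EuclideanSpace.norm_sq_eq]
      refine (Finset.sum_le_sum fun p _ => pow_le_pow_left₀ (norm_nonneg _)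
        ((norm_le_pi_norm (blk X p.1) p.2).trans (hX.2 p.1)) 2).trans ?_
      exact Finset.sum_sq_le_sq_sum_of_nonneg fun _ _ => hR0
    exact (pow_le_pow_iff_left₀ (norm_nonneg _) (Finset.sum_nonneg fun _ _ => hR0) two_ne_zero).1 h
  have hcont : ContinuousOn G.obj S := G.continuousOn_obj.mono fun X hX => hX.1.1
  have hmemS : ∀ Y ∈ G.space, G.obj Y ≤ G.obj X₀ → blk Y a = one → Y ∈ S :=
    fun Y hY hle hYa => ⟨hY, hR Y hY.1 hle hYa⟩
  have hY₀S := hmemS Y₀ hY₀ hobj₀.le hY₀a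
  obtain ⟨Z, hZ, hmin⟩ :=
    (Metric.isCompact_of_isClosed_isBounded hclosed hbdd).exists_isMinOn ⟨Y₀, hY₀S⟩ hcont
  refine ⟨Z, hZ.1, fun X hX => ?_⟩
  obtain ⟨Y, hY, hobj, hYa⟩ := ha X hX
  rcases le_total (G.obj Y) (G.obj X₀) with hle | hle
  · rw [← hobj]
    exact isMinOn_iff.1 hmin Y (hmemS Y hY hle hYa)
  · rw [← hobj]
    exact (isMinOn_iff.1 hmin Y₀ hY₀S).trans (hobj₀.le.trans hle)

theorem exists_constants [Fintype V] [DecidableEq V]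
    (hconn : (SimpleGraph.fromRel fun i j : V => (i, j) ∈ G.edges).Connected)
    (hanch : G.anchors.Nonempty) (c : ℝ) {Δbar : ℝ} (hΔ : 0 ≤ Δbar) :
    ∃ L β : ℝ, 0 ≤ L ∧ 0 < β ∧ ∀ X ∈ G.space, G.obj X ≤ c →
      G.LipType Δbar L X ∧ G.LipTypeAbs Δbar L X ∧ G.HessBound β X := by
  obtain ⟨a, ha⟩ := hanch
  obtain ⟨R, hR0, hR⟩ := G.exists_norm_blk_le hconn a c
  set Z := ∑ e ∈ G.edges, ‖G.meas e‖ with hZ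
  have hZ0 : 0 ≤ Z := Finset.sum_nonneg fun _ _ => norm_nonneg _
  have hmeas : ∀ e ∈ G.edges, ‖G.meas e‖ ≤ R + Z := fun e he =>
    (Finset.single_le_sum (f := fun e => ‖G.meas e‖) (fun _ _ => norm_nonneg _) he).trans
      (by linarith)
  obtain ⟨L, hL0, hL⟩ := G.exists_lipType (R + Z) Δbar (by positivity) hΔ hmeas
  obtain ⟨β, hβ0, hβ⟩ := G.exists_hessBound (R + Z) (by positivity) hmeas
  refine ⟨L, β, hL0, hβ0, fun X hX hc => ?_⟩
  have hXR : ∀ i, ‖blk X i‖ ≤ R + Z := fun i =>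
    (hR X hX.1 hc (hX.2 a ha) i).trans (by linarith)
  exact ⟨(hL X hX hXR).1, (hL X hX hXR).2, hβ X hX.1 hXR⟩

end PoseGraph

/-! ### The trust-region iteration -/

/-- The counting argument. Each step either decreases `f` by `c` while at most doubling the radius,
or does not increase `f` and divides the radius by `4`. The potential
`(3/2) (f 0 - f k) / c + (1/2) log₂ (Δ 0 / Δ k)` grows by at least `1` in both cases. -/
theorem le_of_steps {f Δ : ℕ → ℝ} {c : ℝ} (hc : 0 < c) (hΔ : ∀ k, 0 < Δ k) {K : ℕ}
    (hstep : ∀ k < K, (f (k + 1) ≤ f k - c ∧ Δ (k + 1) ≤ 2 * Δ k) ∨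
      (f (k + 1) ≤ f k ∧ Δ (k + 1) ≤ 1 / 4 * Δ k)) :
    (K : ℝ) ≤ 3 / 2 * ((f 0 - f K) / c) + 1 / 2 * Real.logb 2 (Δ 0 / Δ K) := by
  induction K with
  | zero => simp [(hΔ 0).ne']
  | succ K ih =>
    have ih := ih fun k hk => hstep k (hk.trans K.lt_succ_self)
    have hlog : ∀ k, Real.logb 2 (Δ 0 / Δ k) = Real.logb 2 (Δ 0) - Real.logb 2 (Δ k) := fun k =>
      Real.logb_div (hΔ 0).ne' (hΔ k).ne'
    have hdiv : ∀ k, (f 0 - f k) / c = f 0 / c - f k / c := fun k => sub_div _ _ _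
    rw [hlog, hdiv] at ih ⊢
    push_cast
    rcases hstep K K.lt_succ_self with ⟨h1, h2⟩ | ⟨h1, h2⟩
    · have h3 : f (K + 1) / c ≤ f K / c - 1 := by
        rw [div_le_iff₀ hc, sub_mul, div_mul_cancel₀ _ hc.ne', one_mul]; exact h1
      have h4 : Real.logb 2 (Δ (K + 1)) ≤ 1 + Real.logb 2 (Δ K) := by
        calc _ ≤ Real.logb 2 (2 * Δ K) := Real.logb_le_logb_of_le one_lt_two (hΔ _) h2
          _ = _ := by
            rw [Real.logb_mul two_ne_zero (hΔ K).ne', Real.logb_self_eq_one one_lt_two]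
      linarith
    · have h3 : f (K + 1) / c ≤ f K / c := div_le_div_of_nonneg_right h1 hc.le
      have h4 : Real.logb 2 (Δ (K + 1)) ≤ -2 + Real.logb 2 (Δ K) := by
        have h5 : Real.logb 2 (1 / 4 : ℝ) = -2 := by
          rw [show (1 / 4 : ℝ) = 2 ^ (-2 : ℝ) by
            rw [Real.rpow_neg two_pos.le]; norm_num]
          exact Real.logb_rpow two_pos (by norm_num)
        calc _ ≤ Real.logb 2 (1 / 4 * Δ K) := Real.logb_le_logb_of_le one_lt_two (hΔ _) h2
          _ = _ := by rw [Real.logb_mul (by norm_num) (hΔ K).ne', h5]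
      linarith

theorem lam_eq {L β : ℝ} (hL : 0 ≤ L) (hβ : 0 < β) : lam L β = 1 / (8 * (L + β)) := by
  rw [lam, min_eq_right (one_div_le_one_div_of_le hβ (by linarith))]
  field_simp
  norm_num

namespace PoseGraph

variable {V : Type*} [Fintype V] [DecidableEq V] (G : PoseGraph V)

theorem step_spec (p : Params) {X : Amb V} (hX : X ∈ G.space) {Δ : ℝ} (hΔ : 0 ≤ Δ) :
    G.step p X Δ ∈ G.tangent X ∧ ‖G.step p X Δ‖ ≤ Δ ∧
      0 ≤ G.model X 0 - G.model X (G.step p X Δ) := by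
  obtain ⟨h1, h2⟩ := tcg_spec (G.hessLin_isSymmetric X) (G.grad X) hΔ p.κ p.θ p.maxInner
  refine ⟨tcg_mem (G.tangentSubmodule X) (G.hess_mem_tangent hX.1) (G.grad_mem_tangent hX.1)
    Δ p.κ p.θ p.maxInner, h1, ?_⟩
  rw [model_eq, model_eq, show quad (G.hessLin X) (-G.grad X) 0 = 0 by simp [quad]]
  change _ ≤ _ - (_ + quad _ _ (tcg (G.hessLin X) (G.grad X) Δ p.κ p.θ p.maxInner))
  linarith

theorem step_decrease {p : Params} (hm : 1 ≤ p.maxInner) {X : Amb V} (hX : X ∈ G.space)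
    {Δ β : ℝ} (hΔ : 0 ≤ Δ) (hβ0 : 0 < β) (hβ : G.HessBound β X) (hg : G.grad X ≠ 0) :
    1 / 2 * (‖G.grad X‖ * min Δ (‖G.grad X‖ / β)) ≤
      G.model X 0 - G.model X (G.step p X Δ) := by
  have h := tcg_cauchy_decrease (G.hessLin_isSymmetric X) hΔ hg hβ0
    (G.inner_hess_le hβ (G.grad_mem_tangent hX.1)) p.κ p.θ hm
  rw [model_eq, model_eq, show quad (G.hessLin X) (-G.grad X) 0 = 0 by simp [quad]]
  change _ ≤ _ - (_ + quad _ _ (tcg (G.hessLin X) (G.grad X) Δ p.κ p.θ p.maxInner))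
  linarith

/-- An accepted step realizes the fraction `ρ'` of the predicted decrease. -/
theorem le_sub_of_lt_ratio {X S : Amb V} {ρ' : ℝ} (hρ : 0 ≤ ρ') (hS : 0 ≤ G.model X 0 - G.model X S)
    (h : ρ' < G.ratio X S) : ρ' * (G.model X 0 - G.model X S) ≤ G.obj X - G.obj (Exp X S) := by
  rw [ratio, Exp_zero] at h
  rcases hS.eq_or_lt with h0 | h0
  · -- a vanishing denominator gives the junk value `0` of the ratio, and the step is rejected
    rw [← h0, div_zero] at h
    exact absurd h hρ.not_gt
  · exact ((lt_div_iff₀ h0).1 h).le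

theorem nextIterate_spec {p : Params} (hρ : 0 ≤ p.ρ') {X : Amb V} (hX : X ∈ G.space) {Δ : ℝ}
    (hΔ : 0 ≤ Δ) : G.nextIterate p X (G.step p X Δ) ∈ G.space ∧
      G.obj (G.nextIterate p X (G.step p X Δ)) ≤ G.obj X := by
  obtain ⟨h1, -, h3⟩ := G.step_spec p hX hΔ
  rw [nextIterate]
  split_ifs with h
  · refine ⟨G.Exp_mem_space hX h1, ?_⟩
    have := G.le_sub_of_lt_ratio hρ h3 h
    linarith [mul_nonneg hρ h3]
  · exact ⟨hX, le_rfl⟩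

theorem nextRadius_pos {p : Params} {X S : Amb V} {Δ : ℝ} (h0 : 0 < Δ) (hΔ : Δ ≤ p.Δbar) :
    0 < G.nextRadius p X S Δ ∧ G.nextRadius p X S Δ ≤ p.Δbar ∧ G.nextRadius p X S Δ ≤ 2 * Δ := by
  rw [nextRadius]
  split_ifs
  · exact ⟨by linarith, by linarith, by linarith⟩
  · exact ⟨lt_min (by linarith) (by linarith), min_le_right _ _, min_le_left _ _⟩
  · exact ⟨h0, hΔ, by linarith⟩

/-- If the radius is small compared with the gradient, then the ratio is not below `1/4`. Only the
bound of the objective from above enters, since the Gauss-Newton operator is positive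
semidefinite. -/
theorem one_fourth_le_ratio {p : Params} (hm : 1 ≤ p.maxInner) {X : Amb V} (hX : X ∈ G.space)
    {Δ L β : ℝ} (hΔ0 : 0 < Δ) (hΔ : Δ ≤ p.Δbar) (hL0 : 0 ≤ L) (hβ0 : 0 < β)
    (hL : G.LipType p.Δbar L X) (hβ : G.HessBound β X) (hg : 0 < ‖G.grad X‖)
    (hsmall : Δ ≤ 4 * lam L β * ‖G.grad X‖) : 1 / 4 ≤ G.ratio X (G.step p X Δ) := by
  obtain ⟨h1, h2, -⟩ := G.step_spec p hX hΔ0.le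
  have hdec := G.step_decrease hm hX hΔ0.le hβ0 hβ (norm_pos_iff.1 hg)
  have hlip := hL _ h1 (h2.trans hΔ)
  set S := G.step p X Δ
  have hpsd := G.inner_hess_self_nonneg X S
  have hLβ : 0 < L + β := by linarith
  have hsmall' : 2 * (L + β) * Δ ≤ ‖G.grad X‖ := by
    rw [lam_eq hL0 hβ0] at hsmall
    calc _ ≤ 2 * (L + β) * (4 * (1 / (8 * (L + β))) * ‖G.grad X‖) := by gcongr
      _ = _ := by field_simp; norm_num
  have hmin : min Δ (‖G.grad X‖ / β) = Δ := by
    refine min_eq_left ((le_div_iff₀ hβ0).2 ?_)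
    nlinarith
  rw [hmin] at hdec
  have hden : 0 < G.model X 0 - G.model X S := lt_of_lt_of_le (by positivity) hdec
  rw [ratio, Exp_zero, le_div_iff₀ hden]
  have hS2 : L / 2 * ‖S‖ ^ 2 ≤ 1 / 4 * (‖G.grad X‖ * Δ) := by
    calc _ ≤ L / 2 * Δ ^ 2 := by gcongr
      _ = 1 / 4 * (2 * L * Δ * Δ) := by ring
      _ ≤ 1 / 4 * (2 * (L + β) * Δ * Δ) := by gcongr; linarith
      _ ≤ _ := by gcongr
  have hmod : G.model X 0 - G.model X S =
      -inner ℝ S (G.grad X) - 1 / 2 * inner ℝ S (G.hess X S) := by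
    simp [model]
    ring
  linarith

variable {p : Params} {X₀ : Amb V} {Δ₀ : ℝ}

theorem rtr_spec (hρ : 0 ≤ p.ρ') (hX₀ : X₀ ∈ G.space) (hΔ₀ : Δ₀ ∈ Set.Ioc 0 p.Δbar) (k : ℕ) :
    (G.rtr p X₀ Δ₀ k).1 ∈ G.space ∧ G.obj (G.rtr p X₀ Δ₀ k).1 ≤ G.obj X₀ ∧
      0 < (G.rtr p X₀ Δ₀ k).2 ∧ (G.rtr p X₀ Δ₀ k).2 ≤ p.Δbar := by
  induction k with
  | zero => exact ⟨hX₀, le_rfl, hΔ₀.1, hΔ₀.2⟩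
  | succ k ih =>
    obtain ⟨h1, h2, h3, h4⟩ := ih
    obtain ⟨h5, h6⟩ := G.nextIterate_spec hρ h1 h3.le
    obtain ⟨h7, h8, -⟩ := G.nextRadius_pos (X := (G.rtr p X₀ Δ₀ k).1)
      (S := G.step p (G.rtr p X₀ Δ₀ k).1 (G.rtr p X₀ Δ₀ k).2) h3 h4
    exact ⟨h5, h6.trans h2, h7, h8⟩

/-- As long as the gradient exceeds the tolerance, the radius stays bounded away from `0`. -/
theorem le_radius (hρ : 0 ≤ p.ρ') (hm : 1 ≤ p.maxInner) (hX₀ : X₀ ∈ G.space)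
    (hΔ₀ : Δ₀ ∈ Set.Ioc 0 p.Δbar) {L β ε : ℝ} (hL0 : 0 ≤ L) (hβ0 : 0 < β) (hε : 0 < ε)
    (hεΔ : lam L β * ε ≤ Δ₀) {K : ℕ}
    (hK : ∀ k < K, ε < ‖G.grad (G.rtr p X₀ Δ₀ k).1‖ ∧
      G.LipType p.Δbar L (G.rtr p X₀ Δ₀ k).1 ∧ G.HessBound β (G.rtr p X₀ Δ₀ k).1) :
    lam L β * ε ≤ (G.rtr p X₀ Δ₀ K).2 := by
  induction K with
  | zero => exact hεΔ
  | succ K ih =>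
    have ih := ih fun k hk => hK k (hk.trans K.lt_succ_self)
    obtain ⟨hgε, hL, hβ⟩ := hK K K.lt_succ_self
    obtain ⟨h1, -, h3, h4⟩ := G.rtr_spec hρ hX₀ hΔ₀ K
    change _ ≤ G.nextRadius p _ _ _
    rw [nextRadius]
    split_ifs with hr
    · by_contra! hc
      have hl : 0 < lam L β := by
        rw [lam_eq hL0 hβ0]
        have : 0 < L + β := by linarith
        positivity
      refine absurd (G.one_fourth_le_ratio hm h1 h3 h4 hL0 hβ0 hL hβ (hε.trans hgε) ?_) hr.not_ge
      calc (G.rtr p X₀ Δ₀ K).2 ≤ 4 * lam L β * ε := by linarith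
        _ ≤ _ := by gcongr
    · exact ih.trans (le_min (by linarith) h4)
    · exact ih

/-- If the gradient exceeds the tolerance at the first `K` iterates, then `K` is bounded: the radius
stays above `lam L β * ε`, so every accepted step decreases the objective by a fixed amount. -/
theorem iterations_le (hρ : p.ρ' ∈ Set.Ioo (0 : ℝ) (1 / 4)) (hm : 1 ≤ p.maxInner)
    (hX₀ : X₀ ∈ G.space) (hΔ₀ : Δ₀ ∈ Set.Ioc 0 p.Δbar) {L β ε fstar : ℝ} (hL0 : 0 ≤ L)
    (hβ0 : 0 < β) (hε : 0 < ε) (hεΔ : ε ≤ Δ₀ / lam L β)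
    (hf : ∀ X ∈ G.space, fstar ≤ G.obj X) {K : ℕ}
    (hK : ∀ k < K, ε < ‖G.grad (G.rtr p X₀ Δ₀ k).1‖ ∧
      G.LipType p.Δbar L (G.rtr p X₀ Δ₀ k).1 ∧ G.HessBound β (G.rtr p X₀ Δ₀ k).1) :
    (K : ℝ) ≤ (G.obj X₀ - fstar) / (p.ρ' * lam L β) * (3 / ε ^ 2)
      + 1 / 2 * Real.logb 2 (Δ₀ / (lam L β * ε)) := by
  have hLβ : 0 < L + β := by linarith
  have hl : 0 < lam L β := by
    rw [lam_eq hL0 hβ0]; positivity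
  have hεΔ' : lam L β * ε ≤ Δ₀ := by
    rw [mul_comm]; exact (le_div_iff₀ hl).1 hεΔ
  have hρ0 := hρ.1
  have hrad : ∀ k ≤ K, lam L β * ε ≤ (G.rtr p X₀ Δ₀ k).2 := fun k hk =>
    G.le_radius hρ0.le hm hX₀ hΔ₀ hL0 hβ0 hε hεΔ' fun j hj => hK j (hj.trans_le hk)
  set c := p.ρ' * (1 / 2 * (ε * (lam L β * ε))) with hc
  have hc0 : 0 < c := by positivity
  have hpos := fun k => (G.rtr_spec hρ0.le hX₀ hΔ₀ k).2.2.1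
  have hcount := le_of_steps (f := fun k => G.obj (G.rtr p X₀ Δ₀ k).1)
    (Δ := fun k => (G.rtr p X₀ Δ₀ k).2) hc0 hpos (K := K) fun k hk => by
    obtain ⟨hgε, -, hβ⟩ := hK k hk
    obtain ⟨h1, -, h3, h4⟩ := G.rtr_spec hρ0.le hX₀ hΔ₀ k
    obtain ⟨-, -, hmod⟩ := G.step_spec p h1 h3.le
    have hr := hrad k hk.le
    change (G.obj (G.nextIterate p _ _) ≤ _ ∧ G.nextRadius p _ _ _ ≤ _) ∨
      (G.obj (G.nextIterate p _ _) ≤ _ ∧ G.nextRadius p _ _ _ ≤ _)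
    by_cases hacc : p.ρ' < G.ratio (G.rtr p X₀ Δ₀ k).1
        (G.step p (G.rtr p X₀ Δ₀ k).1 (G.rtr p X₀ Δ₀ k).2)
    · refine Or.inl ⟨?_, (G.nextRadius_pos h3 h4).2.2⟩
      rw [nextIterate, if_pos hacc]
      have hg0 := hε.trans hgε
      have hdec := G.step_decrease hm h1 h3.le hβ0 hβ (norm_pos_iff.1 hg0)
      have hred := G.le_sub_of_lt_ratio hρ0.le hmod hacc
      have hmin : lam L β * ε ≤ min (G.rtr p X₀ Δ₀ k).2 (‖G.grad (G.rtr p X₀ Δ₀ k).1‖ / β) := by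
        refine le_min hr ?_
        rw [lam_eq hL0 hβ0, le_div_iff₀ hβ0, div_mul_eq_mul_div, div_mul_eq_mul_div,
          div_le_iff₀ (by positivity)]
        nlinarith [mul_pos hβ0 hε, mul_le_mul_of_nonneg_right hgε.le hβ0.le,
          mul_nonneg hL0 hg0.le, mul_pos hβ0 hg0]
      have hce : c ≤ p.ρ' * (1 / 2 * (‖G.grad (G.rtr p X₀ Δ₀ k).1‖ *
          min (G.rtr p X₀ Δ₀ k).2 (‖G.grad (G.rtr p X₀ Δ₀ k).1‖ / β))) := by
        rw [hc]; gcongr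
      have := mul_le_mul_of_nonneg_left hdec hρ0.le
      linarith
    · refine Or.inr ⟨?_, ?_⟩
      · rw [nextIterate, if_neg hacc]
      · rw [nextRadius, if_pos ((not_lt.1 hacc).trans_lt hρ.2)]
  have hfK := hf _ (G.rtr_spec hρ0.le hX₀ hΔ₀ K).1
  calc (K : ℝ) ≤ _ := hcount
    _ ≤ 3 / 2 * ((G.obj X₀ - fstar) / c) + 1 / 2 * Real.logb 2 (Δ₀ / (lam L β * ε)) := by
      have h1 : (G.obj X₀ - G.obj (G.rtr p X₀ Δ₀ K).1) / c ≤ (G.obj X₀ - fstar) / c :=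
        div_le_div_of_nonneg_right (by linarith) hc0.le
      have h2 : Real.logb 2 (Δ₀ / (G.rtr p X₀ Δ₀ K).2) ≤ Real.logb 2 (Δ₀ / (lam L β * ε)) :=
        Real.logb_le_logb_of_le one_lt_two (div_pos hΔ₀.1 (hpos K))
          (div_le_div_of_nonneg_left hΔ₀.1.le (by positivity) (hrad K le_rfl))
      exact add_le_add (mul_le_mul_of_nonneg_left h1 (by norm_num))
        (mul_le_mul_of_nonneg_left h2 (by norm_num))
    _ = _ := by
      rw [hc]
      field_simp

end PoseGraph

end PUDQ

end

theorem theorem3 {V : Type*} [Fintype V] [DecidableEq V] (G : PUDQ.PoseGraph V)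
    (hconn : (SimpleGraph.fromRel fun i j : V => (i, j) ∈ G.edges).Connected)
    (X₀ : PUDQ.Amb V) (hX₀ : X₀ ∈ G.space) :
    -- the objective has a global minimizer
    ∃ Xstar ∈ G.space, (∀ X ∈ G.space, G.obj Xstar ≤ G.obj X) ∧
      -- the constants exist, uniformly on the sublevel set of the initial point
      (G.anchors.Nonempty → ∀ Δbar : ℝ, 0 < Δbar → ∃ L β : ℝ, 0 ≤ L ∧ 0 < β ∧
        ∀ X ∈ G.space, G.obj X ≤ G.obj X₀ →
          G.LipType Δbar L X ∧ G.LipTypeAbs Δbar L X ∧ G.HessBound β X) ∧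
      -- whatever the parameters, the iterates stay in that sublevel set
      ∀ (p : PUDQ.Params) (Δ₀ : ℝ), p.ρ' ∈ Set.Ioo (0 : ℝ) (1 / 4) → 1 ≤ p.maxInner →
        Δ₀ ∈ Set.Ioc 0 p.Δbar →
        (∀ k, (G.rtr p X₀ Δ₀ k).1 ∈ G.space ∧ G.obj (G.rtr p X₀ Δ₀ k).1 ≤ G.obj X₀) ∧
        -- and the iteration bound holds for all constants that are valid at the iterates computed
        ∀ L β ε : ℝ, 0 ≤ L → 0 < β → 0 < ε → ε ≤ Δ₀ / PUDQ.lam L β →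
          (∀ k, (∀ j ≤ k, ε < ‖G.grad (G.rtr p X₀ Δ₀ j).1‖) →
            G.LipType p.Δbar L (G.rtr p X₀ Δ₀ k).1 ∧ G.HessBound β (G.rtr p X₀ Δ₀ k).1) →
          ∃ k : ℕ, ‖G.grad (G.rtr p X₀ Δ₀ k).1‖ ≤ ε ∧
            (k : ℝ) ≤ (G.obj X₀ - G.obj Xstar) / (p.ρ' * PUDQ.lam L β) * (3 / ε ^ 2)
              + 1 / 2 * Real.logb 2 (Δ₀ / (PUDQ.lam L β * ε)) := by
  classical
  obtain ⟨Xstar, hXstar, hmin⟩ := G.exists_minimizer hconn hX₀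
  refine ⟨Xstar, hXstar, hmin, fun hanch Δbar hΔbar =>
    G.exists_constants hconn hanch (G.obj X₀) hΔbar.le, fun p Δ₀ hρ hm hΔ₀ => ⟨fun k => ?_, ?_⟩⟩
  · obtain ⟨h1, h2, -⟩ := G.rtr_spec hρ.1.le hX₀ hΔ₀ k
    exact ⟨h1, h2⟩
  · intro L β ε hL0 hβ0 hε hεΔ hvalid
    have hbound : ∀ K : ℕ, (∀ k < K, ε < ‖G.grad (G.rtr p X₀ Δ₀ k).1‖) → (K : ℝ) ≤
        (G.obj X₀ - G.obj Xstar) / (p.ρ' * PUDQ.lam L β) * (3 / ε ^ 2)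
          + 1 / 2 * Real.logb 2 (Δ₀ / (PUDQ.lam L β * ε)) := fun K hK =>
      G.iterations_le hρ hm hX₀ hΔ₀ hL0 hβ0 hε hεΔ hmin fun k hk =>
        ⟨hK k hk, hvalid k fun j hj => hK j (hj.trans_lt hk)⟩
    have hex : ∃ k, ‖G.grad (G.rtr p X₀ Δ₀ k).1‖ ≤ ε := by
      by_contra! hall
      obtain ⟨n, hn⟩ := exists_nat_gt ((G.obj X₀ - G.obj Xstar) / (p.ρ' * PUDQ.lam L β) *
        (3 / ε ^ 2) + 1 / 2 * Real.logb 2 (Δ₀ / (PUDQ.lam L β * ε)))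
      exact absurd (hbound n fun k _ => hall k) hn.not_ge
    exact ⟨Nat.find hex, Nat.find_spec hex,
      hbound _ fun k hk => not_le.1 (Nat.find_min hex hk)⟩
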